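/- Let $k\ge 1$ and $n>2k$ be integers, and let $\Delta_\xi=-\sum_{i=1}^n\partial_i^2$ be the non-negative Laplacian on $\mathbb R^n$. For $\alpha>0$, a fundamental solution of $(\Delta_\xi+\alpha)^k$ in $\mathbb R^n$ is a function $G(x,y)$, $x\ne y$, such that for every $x\in\mathbb R^n$ one has $G(x,\cdot)\in L^1_{loc}(\mathbb R^n)$ and $$\int_{\mathbb R^n}G(x,y)\,(\Delta_\xi+\alpha)^k\varphi(y)\,dy=\varphi(x)\qquad\text{for all }\varphi\in C_c^\infty(\mathbb R^n).$$ Let $\mathfrak H_k$ be the class of functions $u\in C^{2k}(\{(x,y)\in\mathbb R^n\times\mathbb R^n: x\neq y\})$ such that (i) there is $C>0$ with $|u(x,y)|\le C|x-y|^{-(n-2k)}$ whenever $0<|x-y|\le 1$, and (ii) for every $p\ge 1$ there is $C_p>0$ with $|\nabla^l u(x,y)|\le C_p|x-y|^{-p}$ for all $l=0,\dots,2k$ and all $|x-y|\ge 1$. Put $$c_{n,k}=\frac{\Gamma\left(\frac{n-2k}{2}\right)}{4^k\pi^{n/2}(k-1)!},\qquad \eta(t)=\begin{cases}t & n=2k+1,\\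 t^2(1+|\log t|) & n=2k+2,\\ t^2 & n\ge 2k+3,\end{cases}\qquad 0<t\le 1 .$$ For every $\alpha>0$ there is exactly one fundamental solution of $(\Delta_\xi+\alpha)^k$ in the class $\mathfrak H_k$; denote it by $G_\alpha^{(k)}$. Moreover: 1. There is a constant $C>0$ depending only on $n,k$ (not on $\alpha$) such that for all $\alpha>0$ and all $x\ne y$ in $\mathbb R^n$ with $\sqrt\alpha|x-y|\le 1$, $$G_\alpha^{(k)}(x,y)=c_{n,k}|x-y|^{2k-n}(1+\varepsilon),\qquad |\varepsilon|\le C\,\eta(\sqrt\alpha|x-y|).$$ 2. For every $l=1,\dots,2k-1$ there is a constant $C_l>0$ depending only on $n,k,l$ (not on $\alpha$) such that for all $\alpha>0$ and all $x\ne y$ in $\mathbb R^n$ with $\sqrt\alpha|x-y|\le1$, $$\left|\nabla_y^l\left(|x-y|^{n-2k}G_\alpha^{(k)}(x,y)\right)\right|\le C_l\,|x-y|^{-l}\,\eta(\sqrt\alpha|x-y|).$$ -/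

import Mathlib

open Real MeasureTheory Set
open scoped ContDiff

/-- The operator `u ↦ (Δ_ξ + α) u` on functions on `ℝⁿ`, where `Δ_ξ = -∑ᵢ ∂ᵢ²` is the
non-negative Euclidean Laplacian (minus the Laplacian of Mathlib). -/
noncomputable def shiftedLaplacian (n : ℕ) (α : ℝ) (u : EuclideanSpace ℝ (Fin n) → ℝ) :
    EuclideanSpace ℝ (Fin n) → ℝ :=
  fun y => -(Laplacian.laplacian u y) + α * u y

/-- `G` is a fundamental solution of `(Δ_ξ + α)^k` in `ℝⁿ`: every `G x` is locally integrable,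
and `∫ G(x,y) (Δ_ξ + α)^k φ(y) dy = φ(x)` for all test functions `φ ∈ C_c^∞(ℝⁿ)`. The values of
`G` on the diagonal, a null set of each slice, play no role. -/
def IsFundamentalSolution (n k : ℕ) (α : ℝ)
    (G : EuclideanSpace ℝ (Fin n) → EuclideanSpace ℝ (Fin n) → ℝ) : Prop :=
  ∀ x : EuclideanSpace ℝ (Fin n),
    LocallyIntegrable (G x) volume ∧
      ∀ φ : EuclideanSpace ℝ (Fin n) → ℝ, ContDiff ℝ ∞ φ → HasCompactSupport φ →
        ∫ y, G x y * (shiftedLaplacian n α)^[k] φ y = φ x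

/-- The class `ℌ_k` of functions `u ∈ C^{2k}(ℝⁿ × ℝⁿ \ Diag)` which are
`O(|x - y|^{-(n - 2k)})` for `|x - y| ≤ 1`, and whose derivatives of order `0, …, 2k`
(in both variables) decay faster than any power of `|x - y|` for `|x - y| ≥ 1`. -/
structure MemClassH (n k : ℕ)
    (u : EuclideanSpace ℝ (Fin n) → EuclideanSpace ℝ (Fin n) → ℝ) : Prop where
  contDiffOn : ContDiffOn ℝ ((2 * k : ℕ) : ℕ∞)
    (fun p : EuclideanSpace ℝ (Fin n) × EuclideanSpace ℝ (Fin n) => u p.1 p.2)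
    {p | p.1 ≠ p.2}
  bound_near : ∃ C : ℝ, 0 < C ∧ ∀ x y : EuclideanSpace ℝ (Fin n), x ≠ y → ‖x - y‖ ≤ 1 →
    |u x y| ≤ C * ‖x - y‖ ^ (-((n : ℝ) - 2 * k))
  bound_far : ∀ p : ℝ, 1 ≤ p → ∃ C : ℝ, 0 < C ∧ ∀ l : ℕ, l ≤ 2 * k →
    ∀ x y : EuclideanSpace ℝ (Fin n), 1 ≤ ‖x - y‖ →
      ‖iteratedFDeriv ℝ l
        (fun q : EuclideanSpace ℝ (Fin n) × EuclideanSpace ℝ (Fin n) => u q.1 q.2) (x, y)‖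
        ≤ C * ‖x - y‖ ^ (-p)

/-- `G` is a Green's function of `(Δ_ξ + α)^k` in `ℝⁿ` in the class `ℌ_k`. -/
structure IsGreenFunction (n k : ℕ) (α : ℝ)
    (G : EuclideanSpace ℝ (Fin n) → EuclideanSpace ℝ (Fin n) → ℝ) : Prop where
  memClassH : MemClassH n k G
  isFundamentalSolution : IsFundamentalSolution n k α G

/-- `c_{n,k} = Γ((n - 2k)/2) / (4^k π^{n/2} (k-1)!)`, used for `k ≥ 1` and `n > 2k`. -/
noncomputable def greenConst (n k : ℕ) : ℝ :=
  1 / (4 ^ k * π ^ ((n : ℝ) / 2) * (Nat.factorial (k - 1) : ℝ)) *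
    Real.Gamma (((n : ℝ) - 2 * k) / 2)

/-- The error function `η(t)`, `0 < t ≤ 1`; for `n > 2k` the last case is `n ≥ 2k + 3`. -/
noncomputable def greenEta (n k : ℕ) (t : ℝ) : ℝ :=
  if n = 2 * k + 1 then t
  else if n = 2 * k + 2 then t ^ 2 * (1 + |Real.log t|)
  else t ^ 2

/-! The inverse of $(\Delta_\xi+\alpha)^k$ is $\frac1{(k-1)!}\int_0^\infty s^{k-1}e^{-\alpha
s}e^{-s\Delta_\xi}\,ds$, so inserting the heat kernel gives an explicit candidate, `greenKernel`.
With $r=|x-y|$, the substitution $s\mapsto r^2s$ turns it into $r^{2k-n}$ times a function of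
$\tau=\alpha r^2$ alone (`greenKernel_eq_rpow_mul`), which is why every constant is independent of
$\alpha$.

At $\tau=0$ this function is the Gamma integral $c_{n,k}$. Its deviation from that value, and its
derivatives $\tau^j\partial_\tau^j$ with $j\ge1$, are all bounded by multiples of one integral,
`besselDefect`. Splitting that integral at $s=1/\tau$ yields the three cases of $\eta$
(`besselDefect_le_greenEta`). A scale-invariant chain rule in $|x-y|^2$
(`norm_iteratedFDeriv_comp_normSq_le`) converts these bounds into bounds on $\nabla_y^l$.

The kernel is a fundamental solution by the Fourier transform: the $s$-integral of Gaussians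
produces the reciprocal of the symbol. For uniqueness, the difference of two Green's functions is
integrable in $y$ and annihilated by the operator; testing against plane waves, whose eigenvalues
$(|t|^2+\alpha)^k$ do not vanish, shows that its Fourier transform is zero. Hence every Green's
function is `greenKernel` off the diagonal, and the estimates transfer. -/

/-! ### Bessel-type integrals: convergence, differentiation, scaling, decay. -/

theorem pow_mul_exp_neg_le_factorial {x : ℝ} (hx : 0 ≤ x) (N : ℕ) :
    x ^ N * exp (-x) ≤ (Nat.factorial N : ℝ) := by
  have h := Real.pow_div_factorial_le_exp x hx N
  rw [div_le_iff₀ (by positivity)] at h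
  rw [Real.exp_neg, ← div_eq_mul_inv, div_le_iff₀ (Real.exp_pos x)]
  linarith

/-- The integral `∫₀^∞ s ^ b exp (-p s - q / s) ds`, a Bessel function of the second kind up to
elementary factors. -/
noncomputable def besselIntegral (b p q : ℝ) : ℝ :=
  ∫ s in Ioi (0 : ℝ), s ^ b * exp (-(p * s) - q / s)

theorem measurable_besselIntegrand (b p q : ℝ) :
    Measurable fun s : ℝ => s ^ b * exp (-(p * s) - q / s) := by
  fun_prop

/-- The inversion $s\mapsto 1/s$ carries this to a Gamma integrand. -/
theorem integrableOn_rpow_mul_exp_neg_div {b q : ℝ} (hb : b < -1) (hq : 0 < q) :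
    IntegrableOn (fun s : ℝ => s ^ b * exp (-(q / s))) (Ioi 0) := by
  have h := integrableOn_rpow_mul_exp_neg_mul_rpow (p := 1) (s := -b - 2) (b := q)
    (by linarith) one_pos hq
  rw [← integrableOn_Ioi_comp_rpow_iff' _ (p := -1) (by norm_num)] at h
  refine h.congr_fun (fun s (hs : 0 < s) => ?_) measurableSet_Ioi
  have : s ^ (-1 - 1 : ℝ) * (s ^ (-1 : ℝ)) ^ (-b - 2) = s ^ b := by
    rw [← rpow_mul hs.le, ← rpow_add hs]; ring_nf
  simp only [smul_eq_mul, rpow_one]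
  rw [← mul_assoc, this, rpow_neg_one, neg_mul, div_eq_mul_inv]

/-- Trades the factor $e^{-ps}$ for a lower power of $s$. For $N$ large the exponent drops below
$-1$, so convergence for every $b$ reduces to the case without $p$. -/
theorem besselIntegrand_le {b p q : ℝ} (hp : 0 < p) (N : ℕ) {s : ℝ} (hs : 0 < s) :
    s ^ b * exp (-(p * s) - q / s) ≤
      (Nat.factorial N / p ^ N) * (s ^ (b - N) * exp (-(q / s))) := by
  have h := pow_mul_exp_neg_le_factorial (mul_pos hp hs).le N
  have e : s ^ b = s ^ (b - N) * s ^ N := by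
    rw [← rpow_natCast s N, ← rpow_add hs]; ring_nf
  have : exp (-(p * s) - q / s) = exp (-(p * s)) * exp (-(q / s)) := by
    rw [← exp_add]; ring_nf
  rw [e, this]
  calc s ^ (b - N) * s ^ N * (exp (-(p * s)) * exp (-(q / s)))
      = ((p * s) ^ N * exp (-(p * s))) / p ^ N * (s ^ (b - N) * exp (-(q / s))) := by
        rw [mul_pow]; field_simp
    _ ≤ _ := by gcongr

theorem integrableOn_besselIntegrand (b : ℝ) {p q : ℝ} (hp : 0 < p) (hq : 0 < q) :
    IntegrableOn (fun s : ℝ => s ^ b * exp (-(p * s) - q / s)) (Ioi 0) := by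
  obtain ⟨N, hN⟩ := exists_nat_gt (b + 1)
  have h := (integrableOn_rpow_mul_exp_neg_div (b := b - N) (by linarith) hq).const_mul
    (Nat.factorial N / p ^ N : ℝ)
  refine Integrable.mono' h (measurable_besselIntegrand b p q).aestronglyMeasurable ?_
  refine (ae_restrict_iff' measurableSet_Ioi).2 (ae_of_all _ fun s (hs : 0 < s) => ?_)
  rw [Real.norm_of_nonneg (by positivity)]
  exact besselIntegrand_le hp N hs

theorem besselIntegral_nonneg (b p q : ℝ) : 0 ≤ besselIntegral b p q :=
  setIntegral_nonneg measurableSet_Ioi fun s (hs : 0 < s) => by positivity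

theorem hasDerivAt_besselIntegral_left (b : ℝ) {p q : ℝ} (hp : 0 < p) (hq : 0 < q) :
    HasDerivAt (fun p => besselIntegral b p q) (-besselIntegral (b + 1) p q) p := by
  have key := hasDerivAt_integral_of_dominated_loc_of_deriv_le
    (μ := volume.restrict (Ioi (0 : ℝ)))
    (F := fun p s => s ^ b * exp (-(p * s) - q / s))
    (F' := fun p s => -(s ^ (b + 1) * exp (-(p * s) - q / s)))
    (bound := fun s => s ^ (b + 1) * exp (-(p / 2 * s) - q / s))
    (x₀ := p) (Ioi_mem_nhds (half_lt_self hp))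
    (Filter.Eventually.of_forall fun p =>
      (measurable_besselIntegrand b p q).aestronglyMeasurable)
    (integrableOn_besselIntegrand b hp hq)
    (measurable_besselIntegrand (b + 1) p q).neg.aestronglyMeasurable
    ?_ (integrableOn_besselIntegrand (b + 1) (half_pos hp) hq) ?_
  · have := key.2
    rwa [integral_neg] at this
  · refine (ae_restrict_iff' measurableSet_Ioi).2
      (ae_of_all _ fun s (hs : 0 < s) r (hr : p / 2 < r) => ?_)
    rw [norm_neg, Real.norm_of_nonneg (by positivity)]
    gcongr
  · refine (ae_restrict_iff' measurableSet_Ioi).2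
      (ae_of_all _ fun s (hs : 0 < s) r (hr : p / 2 < r) => ?_)
    have h1 : HasDerivAt (fun r : ℝ => -(r * s) - q / s) (-s) r := by
      simpa using ((hasDerivAt_id r).mul_const s).neg.sub_const (q / s)
    have h2 := h1.exp.const_mul (s ^ b)
    refine h2.congr_deriv ?_
    rw [rpow_add_one hs.ne']; ring

theorem hasDerivAt_besselIntegral_right (b : ℝ) {p q : ℝ} (hp : 0 < p) (hq : 0 < q) :
    HasDerivAt (fun q => besselIntegral b p q) (-besselIntegral (b - 1) p q) q := by
  have key := hasDerivAt_integral_of_dominated_loc_of_deriv_le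
    (μ := volume.restrict (Ioi (0 : ℝ)))
    (F := fun q s => s ^ b * exp (-(p * s) - q / s))
    (F' := fun q s => -(s ^ (b - 1) * exp (-(p * s) - q / s)))
    (bound := fun s => s ^ (b - 1) * exp (-(p * s) - q / 2 / s))
    (x₀ := q) (Ioi_mem_nhds (half_lt_self hq))
    (Filter.Eventually.of_forall fun q =>
      (measurable_besselIntegrand b p q).aestronglyMeasurable)
    (integrableOn_besselIntegrand b hp hq)
    (measurable_besselIntegrand (b - 1) p q).neg.aestronglyMeasurable
    ?_ (integrableOn_besselIntegrand (b - 1) hp (half_pos hq)) ?_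
  · have := key.2
    rwa [integral_neg] at this
  · refine (ae_restrict_iff' measurableSet_Ioi).2
      (ae_of_all _ fun s (hs : 0 < s) r (hr : q / 2 < r) => ?_)
    rw [norm_neg, Real.norm_of_nonneg (by positivity)]
    gcongr
  · refine (ae_restrict_iff' measurableSet_Ioi).2
      (ae_of_all _ fun s (hs : 0 < s) r (hr : q / 2 < r) => ?_)
    have h1 : HasDerivAt (fun r : ℝ => -(p * s) - r / s) (-(1 / s)) r := by
      simpa using ((hasDerivAt_id r).div_const s).const_sub (-(p * s))
    have h2 := h1.exp.const_mul (s ^ b)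
    refine h2.congr_deriv ?_
    rw [rpow_sub_one hs.ne']; ring

theorem besselIntegral_smul (b p q : ℝ) {c : ℝ} (hc : 0 < c) :
    besselIntegral b p (c * q) = c ^ (b + 1) * besselIntegral b (c * p) q := by
  have h := integral_comp_mul_left_Ioi' (fun s : ℝ => s ^ b * exp (-(p * s) - c * q / s)) 0 hc
  rw [mul_zero] at h
  rw [besselIntegral, ← h, besselIntegral, smul_eq_mul, ← integral_const_mul, ← integral_const_mul]
  refine setIntegral_congr_fun measurableSet_Ioi fun s (hs : 0 < s) => ?_
  rw [mul_rpow hc.le hs.le, rpow_add_one hc.ne', mul_div_mul_left _ _ hc.ne']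
  ring_nf

theorem besselIntegral_zero_left {b q : ℝ} (hb : b < -1) (hq : 0 < q) :
    besselIntegral b 0 q = q ^ (b + 1) * Real.Gamma (-b - 1) := by
  have h := integral_comp_rpow_Ioi (fun s : ℝ => s ^ (-b - 2) * exp (-(q * s))) (p := -1)
    (by norm_num)
  have h2 := Real.integral_rpow_mul_exp_neg_mul_Ioi (a := -b - 1) (r := q) (by linarith) hq
  rw [show -b - 1 - 1 = -b - 2 by ring, ← h] at h2
  rw [besselIntegral, show q ^ (b + 1) = (1 / q) ^ (-b - 1) by
    rw [one_div, inv_rpow hq.le, ← rpow_neg hq.le]; ring_nf, ← h2]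
  refine setIntegral_congr_fun measurableSet_Ioi fun s (hs : 0 < s) => ?_
  have : s ^ (-1 - 1 : ℝ) * (s ^ (-1 : ℝ)) ^ (-b - 2) = s ^ b := by
    rw [← rpow_mul hs.le, ← rpow_add hs]; ring_nf
  simp only [smul_eq_mul]
  rw [abs_neg, abs_one, one_mul, ← mul_assoc, this, rpow_neg_one, div_eq_mul_inv]
  simp

theorem besselIntegral_le_zero_left {b p q : ℝ} (hb : b < -1) (hp : 0 < p) (hq : 0 < q) :
    besselIntegral b p q ≤ besselIntegral b 0 q := by
  refine setIntegral_mono_on (integrableOn_besselIntegrand b hp hq) ?_ measurableSet_Ioi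
    fun s (hs : 0 < s) => ?_
  · simpa using integrableOn_rpow_mul_exp_neg_div hb hq
  · have := mul_pos hp hs
    gcongr

/-- Decay of Bessel integrals in the parameter of the singular term. -/
theorem besselIntegral_le_pow_inv (b : ℝ) {p q q₀ : ℝ} (hp : 0 < p) (hq₀ : 0 < q₀) (hq : q₀ ≤ q)
    (N : ℕ) : besselIntegral b p q ≤
      (Nat.factorial N * 2 ^ N * besselIntegral (b + N) p (q₀ / 2)) * (q ^ N)⁻¹ := by
  have hq' : 0 < q := hq₀.trans_le hq
  rw [show ∀ x y z : ℝ, x * y * z * (q ^ N)⁻¹ = (x * y * (q ^ N)⁻¹) * z by intros; ring,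
    besselIntegral, besselIntegral, ← integral_const_mul]
  refine setIntegral_mono_on (integrableOn_besselIntegrand b hp hq')
    ((integrableOn_besselIntegrand _ hp (half_pos hq₀)).const_mul _) measurableSet_Ioi
    fun s (hs : 0 < s) => ?_
  -- Half of the singular exponent $q/s$ is spent on the decay $q^{-N}$; the other half keeps the
  -- remaining integral convergent at $0$.
  have h := pow_mul_exp_neg_le_factorial (x := q / 2 / s) (by positivity) N
  have e : exp (-(p * s) - q / s) = exp (-(q / 2 / s)) * exp (-(p * s) - q / 2 / s) := by
    rw [← exp_add]; congr 1; field_simp; ring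
  rw [e, rpow_add hs, rpow_natCast]
  calc s ^ b * (exp (-(q / 2 / s)) * exp (-(p * s) - q / 2 / s))
      = ((q / 2 / s) ^ N * exp (-(q / 2 / s))) * (2 ^ N * (q ^ N)⁻¹ *
          (s ^ b * s ^ N * exp (-(p * s) - q / 2 / s))) := by
        rw [div_pow, div_pow]; field_simp
    _ ≤ Nat.factorial N * (2 ^ N * (q ^ N)⁻¹ *
          (s ^ b * s ^ N * exp (-(p * s) - q₀ / 2 / s))) := by
        gcongr
    _ = _ := by ring

/-! ### Deviation from the value at $\tau=0$, and the error function $\eta$. -/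

/-- The quantity controlling the deviation of `besselIntegral b τ q` from its value at `τ = 0`. -/
noncomputable def besselDefect (b q τ : ℝ) : ℝ :=
  ∫ s in Ioi (0 : ℝ), s ^ b * exp (-(q / s)) * min 1 (τ * s)

theorem integrableOn_besselDefect {b q τ : ℝ} (hb : b < -1) (hq : 0 < q) (hτ : 0 ≤ τ) :
    IntegrableOn (fun s : ℝ => s ^ b * exp (-(q / s)) * min 1 (τ * s)) (Ioi 0) := by
  refine Integrable.mono' (integrableOn_rpow_mul_exp_neg_div hb hq)
    (by fun_prop) ?_
  refine (ae_restrict_iff' measurableSet_Ioi).2 (ae_of_all _ fun s (hs : 0 < s) => ?_)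
  have : 0 ≤ min 1 (τ * s) := le_min zero_le_one (by positivity)
  rw [Real.norm_of_nonneg (by positivity)]
  exact mul_le_of_le_one_right (by positivity) (min_le_left _ _)

theorem abs_besselIntegral_sub_zero_left_le {b q τ : ℝ} (hb : b < -1) (hq : 0 < q) (hτ : 0 < τ) :
    |besselIntegral b τ q - besselIntegral b 0 q| ≤ besselDefect b q τ := by
  have h0 : IntegrableOn (fun s : ℝ => s ^ b * exp (-(0 * s) - q / s)) (Ioi 0) := by
    simpa using integrableOn_rpow_mul_exp_neg_div hb hq
  rw [besselIntegral, besselIntegral, ← integral_sub (integrableOn_besselIntegrand b hτ hq) h0]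
  refine (abs_integral_le_integral_abs).trans ?_
  refine setIntegral_mono_on ((integrableOn_besselIntegrand b hτ hq).sub h0).abs
    (integrableOn_besselDefect hb hq hτ.le) measurableSet_Ioi fun s (hs : 0 < s) => ?_
  have e : s ^ b * exp (-(τ * s) - q / s) - s ^ b * exp (-(0 * s) - q / s)
      = -(s ^ b * exp (-(q / s)) * (1 - exp (-(τ * s)))) := by
    rw [show -(τ * s) - q / s = -(q / s) + -(τ * s) by ring, exp_add]; simp; ring
  have h1 : 0 ≤ 1 - exp (-(τ * s)) := by
    simp [(mul_pos hτ hs).le]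
  rw [e, abs_neg, abs_of_nonneg (by positivity)]
  gcongr
  refine le_min (by linarith [exp_pos (-(τ * s))]) ?_
  linarith [add_one_le_exp (-(τ * s))]

/-- Up to sign the left side is $\tau^j$ times the $j$-th $\tau$-derivative of the Bessel integral.
For $j\ge1$ one has $x^je^{-x}\le j!\min(1,x)$, so the derivatives obey the same bound as the
deviation itself. -/
theorem pow_mul_besselIntegral_le {b q τ : ℝ} (hb : b < -1) (hq : 0 < q) (hτ : 0 < τ) (j : ℕ)
    (hj : 1 ≤ j) :
    τ ^ j * besselIntegral (b + j) τ q ≤ Nat.factorial j * besselDefect b q τ := by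
  rw [besselIntegral, besselDefect, ← integral_const_mul, ← integral_const_mul]
  refine setIntegral_mono_on ((integrableOn_besselIntegrand _ hτ hq).const_mul _)
    ((integrableOn_besselDefect hb hq hτ.le).const_mul _) measurableSet_Ioi
    fun s (hs : 0 < s) => ?_
  have hts := mul_pos hτ hs
  have h : (τ * s) ^ j * exp (-(τ * s)) ≤ Nat.factorial j * min 1 (τ * s) := by
    rw [mul_min_of_nonneg _ _ (by positivity)]
    refine le_min (by simpa using pow_mul_exp_neg_le_factorial hts.le j) ?_
    obtain ⟨i, rfl⟩ := Nat.exists_eq_add_of_le' hj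
    have h1 := pow_mul_exp_neg_le_factorial hts.le i
    calc (τ * s) ^ (i + 1) * exp (-(τ * s)) = ((τ * s) ^ i * exp (-(τ * s))) * (τ * s) := by ring
      _ ≤ Nat.factorial i * (τ * s) := by gcongr
      _ ≤ _ := by gcongr; omega
  rw [show -(τ * s) - q / s = -(q / s) + -(τ * s) by ring, exp_add, rpow_add hs, rpow_natCast]
  calc τ ^ j * (s ^ b * s ^ j * (exp (-(q / s)) * exp (-(τ * s))))
      = s ^ b * exp (-(q / s)) * ((τ * s) ^ j * exp (-(τ * s))) := by rw [mul_pow]; ring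
    _ ≤ s ^ b * exp (-(q / s)) * (Nat.factorial j * min 1 (τ * s)) := by gcongr
    _ = _ := by ring

theorem besselDefect_le_mul {b q τ : ℝ} (hb : b + 1 < -1) (hq : 0 < q) (hτ : 0 < τ) :
    besselDefect b q τ ≤ besselIntegral (b + 1) 0 q * τ := by
  rw [besselDefect, besselIntegral, ← integral_mul_const]
  have h0 : IntegrableOn (fun s : ℝ => s ^ (b + 1) * exp (-(0 * s) - q / s)) (Ioi 0) := by
    simpa using integrableOn_rpow_mul_exp_neg_div hb hq
  refine setIntegral_mono_on (integrableOn_besselDefect (by linarith) hq hτ.le)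
    (h0.mul_const _) measurableSet_Ioi
    fun s (hs : 0 < s) => ?_
  rw [rpow_add_one hs.ne']
  calc s ^ b * exp (-(q / s)) * min 1 (τ * s) ≤ s ^ b * exp (-(q / s)) * (τ * s) := by
        gcongr; exact min_le_right _ _
    _ = _ := by simp; ring

theorem setIntegral_besselDefect_Ioi_le {b q T τ : ℝ} (hb : b < -1) (hq : 0 < q) (hτ : 0 < τ)
    (hT : 0 < T) :
    ∫ s in Ioi T, s ^ b * exp (-(q / s)) * min 1 (τ * s) ≤ -T ^ (b + 1) / (b + 1) := by
  rw [← integral_Ioi_rpow_of_lt hb hT]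
  refine setIntegral_mono_on ((integrableOn_besselDefect hb hq hτ.le).mono_set
    (Ioi_subset_Ioi hT.le)) (integrableOn_Ioi_rpow_of_lt hb hT) measurableSet_Ioi
    fun s (hs : T < s) => ?_
  have hs' : 0 < s := hT.trans hs
  have h1 : exp (-(q / s)) ≤ 1 := by simp; positivity
  calc s ^ b * exp (-(q / s)) * min 1 (τ * s) ≤ s ^ b * 1 * 1 := by
        gcongr
        exact min_le_left _ _
    _ = s ^ b := by ring

theorem besselDefect_eq_add {b q τ T : ℝ} (hb : b < -1) (hq : 0 < q) (hτ : 0 < τ) (hT : 0 < T) :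
    besselDefect b q τ = (∫ s in Ioc 0 T, s ^ b * exp (-(q / s)) * min 1 (τ * s)) +
      ∫ s in Ioi T, s ^ b * exp (-(q / s)) * min 1 (τ * s) := by
  have h := integrableOn_besselDefect hb hq hτ.le
  rw [besselDefect, ← Ioc_union_Ioi_eq_Ioi hT.le, setIntegral_union
    (Ioc_disjoint_Ioi le_rfl) measurableSet_Ioi (h.mono_set Ioc_subset_Ioi_self)
    (h.mono_set (Ioi_subset_Ioi hT.le))]

/-- Split at $s=t^{-2}$, where $t^2s=1$. Below it the minimum is at most $t^2s$, above it at most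
$1$; each piece contributes $2t$. -/
theorem besselDefect_le_sqrt {q t : ℝ} (hq : 0 < q) (ht : 0 < t) :
    besselDefect (-3 / 2) q (t ^ 2) ≤ 4 * t := by
  have hT : 0 < (t ^ 2)⁻¹ := by positivity
  rw [besselDefect_eq_add (by norm_num) hq (by positivity) hT]
  have h1 := setIntegral_besselDefect_Ioi_le (b := -3 / 2) (by norm_num) hq
    (by positivity : 0 < t ^ 2) hT
  have e1 : ((t ^ 2)⁻¹) ^ (-3 / 2 + 1 : ℝ) = t := by
    rw [← rpow_natCast, ← rpow_neg ht.le, ← rpow_mul ht.le]; norm_num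
  rw [e1] at h1
  have h2 : ∫ s in Ioc 0 (t ^ 2)⁻¹, s ^ (-3 / 2 : ℝ) * exp (-(q / s)) * min 1 (t ^ 2 * s)
      ≤ ∫ s in Ioc 0 (t ^ 2)⁻¹, t ^ 2 * s ^ (-1 / 2 : ℝ) := by
    refine setIntegral_mono_on ((integrableOn_besselDefect (by norm_num) hq
      (by positivity)).mono_set Ioc_subset_Ioi_self) ?_ measurableSet_Ioc fun s hs => ?_
    · refine Integrable.const_mul ?_ _
      exact (intervalIntegrable_iff_integrableOn_Ioc_of_le hT.le).1
        (intervalIntegral.intervalIntegrable_rpow' (by norm_num))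
    · have hs0 : 0 < s := hs.1
      have h1 : exp (-(q / s)) ≤ 1 := by simp; positivity
      calc s ^ (-3 / 2 : ℝ) * exp (-(q / s)) * min 1 (t ^ 2 * s)
          ≤ s ^ (-3 / 2 : ℝ) * 1 * (t ^ 2 * s) := by
            gcongr
            exact min_le_right _ _
        _ = t ^ 2 * s ^ (-1 / 2 : ℝ) := by
            rw [show (-1 / 2 : ℝ) = -3 / 2 + 1 by norm_num, rpow_add_one hs0.ne']; ring
  have e2 : ∫ s in Ioc 0 (t ^ 2)⁻¹, t ^ 2 * s ^ (-1 / 2 : ℝ) = 2 * t := by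
    rw [integral_const_mul, ← intervalIntegral.integral_of_le hT.le,
      integral_rpow (Or.inl (by norm_num))]
    have e3 : ((t ^ 2)⁻¹) ^ (-1 / 2 + 1 : ℝ) = t⁻¹ := by
      rw [← rpow_natCast, ← rpow_neg ht.le, ← rpow_mul ht.le, ← rpow_neg_one]; norm_num
    rw [e3, zero_rpow (by norm_num)]
    field_simp; norm_num
  have e4 : -t / (-3 / 2 + 1) = 2 * t := by ring
  linarith

/-- Here $t^2s\cdot s^{-2}=t^2s^{-1}$ is not integrable at $0$, so three ranges are needed. On
$(0,1]$ the factor $e^{-q/s}$ gives $t^2q^{-1}$, on $(1,t^{-2}]$ the logarithm appears, and the tail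
gives $t^2$. -/
theorem besselDefect_le_log {q t : ℝ} (hq : 0 < q) (ht : 0 < t) (ht1 : t ≤ 1) :
    besselDefect (-2) q (t ^ 2) ≤ (q⁻¹ + 2) * (t ^ 2 * (1 + |log t|)) := by
  have hT : 0 < (t ^ 2)⁻¹ := by positivity
  have hT1 : 1 ≤ (t ^ 2)⁻¹ := (one_le_inv₀ (by positivity)).2 (pow_le_one₀ ht.le ht1)
  rw [besselDefect_eq_add (by norm_num) hq (by positivity) hT]
  have h1 := setIntegral_besselDefect_Ioi_le (b := -2) (by norm_num) hq
    (by positivity : 0 < t ^ 2) hT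
  have e1 : ((t ^ 2)⁻¹) ^ (-2 + 1 : ℝ) = t ^ 2 := by
    rw [show (-2 + 1 : ℝ) = -1 by norm_num, rpow_neg_one, inv_inv]
  rw [e1] at h1
  have hint := (integrableOn_besselDefect (b := -2) (by norm_num) hq
      (sq_nonneg t)).mono_set (Ioc_subset_Ioi_self : Ioc 0 (t ^ 2)⁻¹ ⊆ Ioi 0)
  have e2 := setIntegral_union (Ioc_disjoint_Ioc_of_le (le_refl (1 : ℝ))) measurableSet_Ioc
    (hint.mono_set (Ioc_subset_Ioc_right hT1)) (hint.mono_set (Ioc_subset_Ioc_left zero_le_one))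
  rw [Ioc_union_Ioc_eq_Ioc zero_le_one hT1] at e2
  have hbd : ∀ s : ℝ, 0 < s → s ^ (-2 : ℝ) * exp (-(q / s)) * min 1 (t ^ 2 * s)
      ≤ t ^ 2 * (s⁻¹ * exp (-(q / s))) := fun s hs => by
    calc s ^ (-2 : ℝ) * exp (-(q / s)) * min 1 (t ^ 2 * s)
        ≤ s ^ (-2 : ℝ) * exp (-(q / s)) * (t ^ 2 * s) := by gcongr; exact min_le_right _ _
      _ = _ := by
        rw [show (s : ℝ)⁻¹ = s ^ (-2 : ℝ) * s by
          rw [← rpow_add_one hs.ne', ← rpow_neg_one]; norm_num]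
        ring
  have h2 : ∫ s in Ioc 0 1, s ^ (-2 : ℝ) * exp (-(q / s)) * min 1 (t ^ 2 * s)
      ≤ ∫ s in Ioc (0 : ℝ) 1, t ^ 2 * q⁻¹ := by
    refine setIntegral_mono_on (hint.mono_set (Ioc_subset_Ioc_right hT1))
      (integrableOn_const (by simp)) measurableSet_Ioc fun s hs => (hbd s hs.1).trans ?_
    have hs0 : 0 < s := hs.1
    gcongr
    have := pow_mul_exp_neg_le_factorial (x := q / s) (by positivity) 1
    rw [pow_one, Nat.factorial_one, Nat.cast_one] at this
    calc s⁻¹ * exp (-(q / s)) = q⁻¹ * (q / s * exp (-(q / s))) := by field_simp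
      _ ≤ q⁻¹ * 1 := by gcongr
      _ = q⁻¹ := mul_one _
  have h3 : ∫ s in Ioc 1 (t ^ 2)⁻¹, s ^ (-2 : ℝ) * exp (-(q / s)) * min 1 (t ^ 2 * s)
      ≤ ∫ s in Ioc 1 (t ^ 2)⁻¹, t ^ 2 * s⁻¹ := by
    refine setIntegral_mono_on (hint.mono_set (Ioc_subset_Ioc_left zero_le_one)) ?_
      measurableSet_Ioc fun s hs => ?_
    · refine Integrable.const_mul ?_ _
      refine (intervalIntegrable_iff_integrableOn_Ioc_of_le hT1).1
        (intervalIntegral.intervalIntegrable_inv (fun s hs => ?_) continuousOn_id)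
      rw [uIcc_of_le hT1] at hs
      exact (zero_lt_one.trans_le hs.1).ne'
    · have hs0 : 0 < s := zero_lt_one.trans hs.1
      refine (hbd s hs0).trans ?_
      have h1 : exp (-(q / s)) ≤ 1 := by simp; positivity
      gcongr
      exact mul_le_of_le_one_right (by positivity) h1
  have e3 : ∫ s in Ioc 1 (t ^ 2)⁻¹, t ^ 2 * s⁻¹ = t ^ 2 * (2 * |log t|) := by
    rw [integral_const_mul, ← intervalIntegral.integral_of_le hT1, integral_inv_of_pos one_pos hT,
      div_one, log_inv, log_pow, abs_of_nonpos (log_nonpos ht.le ht1)]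
    push_cast; ring
  have e4 : ∫ s in Ioc (0 : ℝ) 1, t ^ 2 * q⁻¹ = t ^ 2 * q⁻¹ := by simp
  have h5 : 0 ≤ q⁻¹ * (t ^ 2 * |log t|) := by positivity
  have h6 : 0 ≤ t ^ 2 := sq_nonneg t
  rw [e4] at h2
  rw [e3] at h3
  have e5 : -t ^ 2 / (-2 + 1) = t ^ 2 := by ring
  rw [e2]
  linarith

theorem besselDefect_le_greenEta (n k : ℕ) (hn : 2 * k < n) {q : ℝ} (hq : 0 < q) :
    ∃ C : ℝ, 0 < C ∧ ∀ t : ℝ, 0 < t → t ≤ 1 →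
      besselDefect ((k : ℝ) - 1 - n / 2) q (t ^ 2) ≤ C * greenEta n k t := by
  by_cases h1 : n = 2 * k + 1
  · refine ⟨4, by norm_num, fun t ht _ => ?_⟩
    rw [greenEta, if_pos h1, show (k : ℝ) - 1 - n / 2 = -3 / 2 by subst h1; push_cast; ring]
    exact besselDefect_le_sqrt hq ht
  by_cases h2 : n = 2 * k + 2
  · refine ⟨q⁻¹ + 2, by positivity, fun t ht ht1 => ?_⟩
    rw [greenEta, if_neg h1, if_pos h2,
      show (k : ℝ) - 1 - n / 2 = -2 by subst h2; push_cast; ring]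
    exact besselDefect_le_log hq ht ht1
  · have h3 : (2 * k + 3 : ℝ) ≤ n := by exact_mod_cast (by omega : 2 * k + 3 ≤ n)
    -- Now $b\le-5/2$, so the integral with exponent $b+1$ converges and the deviation is linear in
    -- $\tau$. The summand $1$ only makes the constant visibly positive.
    refine ⟨besselIntegral ((k : ℝ) - 1 - n / 2 + 1) 0 q + 1,
      add_pos_of_nonneg_of_pos (besselIntegral_nonneg _ _ _) one_pos, fun t ht _ => ?_⟩
    rw [greenEta, if_neg h1, if_neg h2]
    refine (besselDefect_le_mul (by linarith) hq (by positivity)).trans ?_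
    gcongr
    linarith

/-! ### Derivatives of functions of a squared norm. -/

theorem iteratedDeriv_eq_of_hasDerivAt_succ {F : ℕ → ℝ → ℝ} {U : Set ℝ} (hU : IsOpen U)
    (hF : ∀ j : ℕ, ∀ p ∈ U, HasDerivAt (F j) (F (j + 1) p) p) (j : ℕ) :
    ∀ p ∈ U, iteratedDeriv j (F 0) p = F j p := by
  induction j with
  | zero => simp
  | succ j ih =>
    intro p hp
    rw [iteratedDeriv_succ]
    have : iteratedDeriv j (F 0) =ᶠ[nhds p] F j := by
      filter_upwards [hU.mem_nhds hp] with r hr using ih r hr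
    rw [this.deriv_eq, (hF j p hp).deriv]

theorem contDiffOn_of_hasDerivAt_succ {F : ℕ → ℝ → ℝ} {U : Set ℝ} (hU : IsOpen U)
    (hF : ∀ j : ℕ, ∀ p ∈ U, HasDerivAt (F j) (F (j + 1) p) p) :
    ContDiffOn ℝ ∞ (F 0) U := by
  have key : ∀ m j : ℕ, ContDiffOn ℝ m (F j) U := by
    intro m
    induction m with
    | zero =>
      exact fun j => contDiffOn_zero.2 fun p hp => (hF j p hp).continuousAt.continuousWithinAt
    | succ m ih =>
      intro j
      rw [Nat.cast_add, Nat.cast_one, contDiffOn_succ_iff_deriv_of_isOpen hU]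
      refine ⟨fun p hp => (hF j p hp).differentiableAt.differentiableWithinAt, by simp, ?_⟩
      exact (ih (j + 1)).congr fun p hp => (hF j p hp).deriv
  exact contDiffOn_infty.2 fun m => key m 0

section Radial

variable {V E : Type*} [NormedAddCommGroup V] [NormedSpace ℝ V] [NormedAddCommGroup E]
  [InnerProductSpace ℝ E]

/-- The bound $\|T\|\le2$ accommodates both $-\mathrm{id}$ (derivatives in $y$) and $(x,y)\mapsto
x-y$ (joint derivatives). The geometric form in $i$ is what the Leibniz and chain rules consume. -/
theorem norm_iteratedFDeriv_affine_le (T : V →L[ℝ] E) (hT : ‖T‖ ≤ 2) (c : E) (v : V)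
    (hv : c + T v ≠ 0) (i : ℕ) :
    ‖iteratedFDeriv ℝ i (fun w => c + T w) v‖ ≤ ‖c + T v‖ * (2 / ‖c + T v‖) ^ i := by
  have hr : 0 < ‖c + T v‖ := norm_pos_iff.2 hv
  have hd : fderiv ℝ (fun w => c + T w) = fun _ => T := by
    ext1 w; rw [fderiv_const_add]; exact T.fderiv
  match i with
  | 0 => simp
  | 1 =>
    have h1 := norm_iteratedFDeriv_fderiv (𝕜 := ℝ) (f := fun w => c + T w) (x := v) (n := 0)
    rw [hd, norm_iteratedFDeriv_zero] at h1
    rw [← h1, pow_one, mul_div_cancel₀ _ hr.ne']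
    exact hT
  | i + 2 =>
    rw [← norm_iteratedFDeriv_fderiv, hd, iteratedFDeriv_succ_const]
    simp; positivity

theorem norm_iteratedFDeriv_normSq_le (T : V →L[ℝ] E) (hT : ‖T‖ ≤ 2) (c : E) (v : V)
    (hv : c + T v ≠ 0) (i : ℕ) :
    ‖iteratedFDeriv ℝ i (fun w => ‖c + T w‖ ^ 2) v‖ ≤
      ‖c + T v‖ ^ 2 * (4 / ‖c + T v‖) ^ i := by
  have hr : 0 < ‖c + T v‖ := norm_pos_iff.2 hv
  have hA : ContDiff ℝ i (fun w => c + T w) := by fun_prop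
  have h := (innerSL ℝ (E := E)).norm_iteratedFDeriv_le_of_bilinear_of_le_one
    hA hA v (n := i) le_rfl (norm_innerSL_le ℝ)
  have e : (fun w => innerSL ℝ (c + T w) (c + T w)) = fun w => ‖c + T w‖ ^ 2 := by
    ext w; rw [innerSL_apply_apply, real_inner_self_eq_norm_sq]
  rw [e] at h
  refine h.trans ?_
  calc _ ≤ ∑ j ∈ Finset.range (i + 1), (i.choose j : ℝ) *
        (‖c + T v‖ * (2 / ‖c + T v‖) ^ j) * (‖c + T v‖ * (2 / ‖c + T v‖) ^ (i - j)) := by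
        gcongr <;> exact norm_iteratedFDeriv_affine_le T hT c v hv _
    _ = ∑ j ∈ Finset.range (i + 1), (i.choose j : ℝ) *
        (‖c + T v‖ ^ 2 * (2 / ‖c + T v‖) ^ i) := by
        refine Finset.sum_congr rfl fun j hj => ?_
        rw [← pow_mul_pow_sub (2 / ‖c + T v‖) (Finset.mem_range_succ_iff.1 hj)]
        ring
    _ = _ := by
        rw [← Finset.sum_mul, ← Nat.cast_sum, Nat.sum_range_choose,
          show (4 : ℝ) / ‖c + T v‖ = 2 * (2 / ‖c + T v‖) by ring, mul_pow]
        push_cast; ring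

/-- Scale-invariant bound for the derivatives of a function of `‖c + T v‖ ^ 2`. -/
theorem norm_iteratedFDeriv_comp_normSq_le (T : V →L[ℝ] E) (hT : ‖T‖ ≤ 2) (c : E) (v : V)
    (hv : c + T v ≠ 0) {F : ℕ → ℝ → ℝ}
    (hF : ∀ j : ℕ, ∀ p ∈ Ioi (0 : ℝ), HasDerivAt (F j) (F (j + 1) p) p) (l : ℕ) {C : ℝ}
    (hC : ∀ i ≤ l, (‖c + T v‖ ^ 2) ^ i * |F i (‖c + T v‖ ^ 2)| ≤ C) :
    ‖iteratedFDeriv ℝ l (fun w => F 0 (‖c + T w‖ ^ 2)) v‖ ≤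
      Nat.factorial l * C * (4 / ‖c + T v‖) ^ l := by
  set r := ‖c + T v‖ with hr_def
  have hr : 0 < r := norm_pos_iff.2 hv
  have hr2 : 0 < r ^ 2 := by positivity
  set U : Set V := {w | c + T w ≠ 0}
  have hU : IsOpen U := isOpen_ne_fun (by fun_prop) (by fun_prop)
  -- Normalising by $r^2$ makes the inner function equal to $1$ at $v$ with $i$-th derivative at
  -- most $(4/r)^i$. The rescaled outer family then has derivatives $r^{2i}F_i(r^2)$ at $1$, exactly
  -- the quantities bounded by $C$.
  set f : V → ℝ := fun w => (r ^ 2)⁻¹ * ‖c + T w‖ ^ 2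
  set G : ℕ → ℝ → ℝ := fun j u => (r ^ 2) ^ j * F j (r ^ 2 * u) with hG_def
  have hfv : f v = 1 := inv_mul_cancel₀ hr2.ne'
  have hf : ContDiff ℝ ∞ f := contDiff_const.mul ((by fun_prop : ContDiff ℝ ∞
    (fun w => c + T w)).norm_sq ℝ)
  have hG : ∀ j : ℕ, ∀ u ∈ Ioi (0 : ℝ), HasDerivAt (G j) (G (j + 1) u) u := by
    intro j u hu
    have h1 := (hF j (r ^ 2 * u) (mul_pos hr2 hu)).comp u ((hasDerivAt_id u).const_mul (r ^ 2))
    exact (h1.const_mul ((r ^ 2) ^ j)).congr_deriv (by simp only [G]; ring)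
  have hfG : (fun w => F 0 (‖c + T w‖ ^ 2)) = G 0 ∘ f := by
    ext w; simp [G, f, mul_inv_cancel_left₀ hr2.ne']
  rw [hfG, ← iteratedFDerivWithin_of_isOpen l hU hv]
  refine norm_iteratedFDerivWithin_comp_le (N := ∞) (t := Ioi 0)
    (contDiffOn_of_hasDerivAt_succ isOpen_Ioi hG) hf.contDiffOn
    (by exact_mod_cast le_top) isOpen_Ioi.uniqueDiffOn hU.uniqueDiffOn
    (fun w (hw : c + T w ≠ 0) => by
      have := norm_pos_iff.2 hw
      show 0 < (r ^ 2)⁻¹ * ‖c + T w‖ ^ 2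
      positivity) hv (fun i hi => ?_) (fun i hi hil => ?_)
  · rw [hfv, iteratedFDerivWithin_of_isOpen i isOpen_Ioi (mem_Ioi.2 one_pos),
      norm_iteratedFDeriv_eq_norm_iteratedDeriv, 
      iteratedDeriv_eq_of_hasDerivAt_succ isOpen_Ioi hG i 1 (mem_Ioi.2 one_pos),
      Real.norm_eq_abs, hG_def]
    simp only [mul_one]
    rw [abs_mul, abs_of_nonneg (by positivity)]
    exact hC i hi
  · rw [iteratedFDerivWithin_of_isOpen i hU hv]
    have e : f = (r ^ 2)⁻¹ • fun w => ‖c + T w‖ ^ 2 := rfl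
    rw [e, iteratedFDeriv_const_smul_apply (((by fun_prop : ContDiff ℝ i
      (fun w => c + T w)).norm_sq ℝ).contDiffAt), norm_smul, Real.norm_of_nonneg (by positivity)]
    have := norm_iteratedFDeriv_normSq_le T hT c v hv i
    calc (r ^ 2)⁻¹ * ‖iteratedFDeriv ℝ i (fun w => ‖c + T w‖ ^ 2) v‖
        ≤ (r ^ 2)⁻¹ * (r ^ 2 * (4 / r) ^ i) := by gcongr
      _ = (4 / r) ^ i := inv_mul_cancel_left₀ hr2.ne' _

end Radial

/-! ### The explicit kernel: expansion, derivative estimates, membership in the class. -/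

/-- The normalisation `(4π)^{-n/2} / (k-1)!` of the kernel of `(Δ + α)^{-k}`. -/
noncomputable def heatConst (n k : ℕ) : ℝ :=
  ((4 * π) ^ ((n : ℝ) / 2) * (Nat.factorial (k - 1) : ℝ))⁻¹

theorem heatConst_pos (n k : ℕ) : 0 < heatConst n k := by
  unfold heatConst; positivity

/-- The kernel `1/(k-1)! ∫₀^∞ s^{k-1} e^{-αs} (4πs)^{-n/2} e^{-|x-y|²/4s} ds` of `(Δ + α)^{-k}`. -/
noncomputable def greenKernel (n k : ℕ) (α : ℝ) (x y : EuclideanSpace ℝ (Fin n)) : ℝ :=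
  heatConst n k * besselIntegral ((k : ℝ) - 1 - n / 2) α (‖x - y‖ ^ 2 / 4)

theorem greenConst_eq (n k : ℕ) (hn : 2 * k < n) :
    greenConst n k = heatConst n k * besselIntegral ((k : ℝ) - 1 - n / 2) 0 (1 / 4) := by
  have hn' : (2 * k : ℝ) < n := by exact_mod_cast hn
  rw [besselIntegral_zero_left (by linarith) (by norm_num), greenConst, heatConst,
    show -((k : ℝ) - 1 - n / 2) - 1 = ((n : ℝ) - 2 * k) / 2 by ring]
  have e : (1 / 4 : ℝ) ^ ((k : ℝ) - 1 - n / 2 + 1) = 4 ^ ((n : ℝ) / 2) / 4 ^ k := by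
    rw [one_div, inv_rpow (by norm_num), ← rpow_neg (by norm_num), ← rpow_natCast 4 k,
      ← rpow_sub (by norm_num)]
    ring_nf
  rw [e, mul_rpow (by norm_num) pi_pos.le]
  field_simp

theorem greenKernel_eq_rpow_mul (n k : ℕ) (α : ℝ) {x y : EuclideanSpace ℝ (Fin n)} (hxy : x ≠ y) :
    greenKernel n k α x y = ‖x - y‖ ^ (2 * (k : ℝ) - n) *
      (heatConst n k * besselIntegral ((k : ℝ) - 1 - n / 2) (α * ‖x - y‖ ^ 2) (1 / 4)) := by
  have hr : 0 < ‖x - y‖ := norm_pos_iff.2 (sub_ne_zero.2 hxy)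
  have h := besselIntegral_smul ((k : ℝ) - 1 - n / 2) α (1 / 4) (c := ‖x - y‖ ^ 2) (by positivity)
  rw [greenKernel, show ‖x - y‖ ^ 2 / 4 = ‖x - y‖ ^ 2 * (1 / 4) by ring, h, ← rpow_natCast, ← rpow_mul hr.le, rpow_natCast]
  rw [show ((2 : ℕ) : ℝ) * ((k : ℝ) - 1 - n / 2 + 1) = 2 * k - n by push_cast; ring,
    mul_comm (‖x - y‖ ^ 2) α]
  ring

theorem greenKernel_expansion (n k : ℕ) (hn : 2 * k < n) :
    ∃ C : ℝ, 0 < C ∧ ∀ α : ℝ, 0 < α → ∀ x y : EuclideanSpace ℝ (Fin n), x ≠ y →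
      √α * ‖x - y‖ ≤ 1 → ∃ ε : ℝ, |ε| ≤ C * greenEta n k (√α * ‖x - y‖) ∧
        greenKernel n k α x y = greenConst n k * ‖x - y‖ ^ (2 * (k : ℝ) - n) * (1 + ε) := by
  have hn' : (2 * k : ℝ) < n := by exact_mod_cast hn
  have hb : (k : ℝ) - 1 - n / 2 < -1 := by linarith
  obtain ⟨C, hC, h⟩ := besselDefect_le_greenEta n k hn (q := 1 / 4) (by norm_num)
  set b := (k : ℝ) - 1 - n / 2 with hb_def
  have hB : 0 < besselIntegral b 0 (1 / 4) := by
    rw [besselIntegral_zero_left hb (by norm_num)]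
    have := Real.Gamma_pos_of_pos (s := -b - 1) (by linarith)
    positivity
  refine ⟨C / besselIntegral b 0 (1 / 4), by positivity, fun α hα x y hxy ht => ?_⟩
  have hr : 0 < ‖x - y‖ := norm_pos_iff.2 (sub_ne_zero.2 hxy)
  have hτ : α * ‖x - y‖ ^ 2 = (√α * ‖x - y‖) ^ 2 := by rw [mul_pow, sq_sqrt hα.le]
  refine ⟨(besselIntegral b (α * ‖x - y‖ ^ 2) (1 / 4) - besselIntegral b 0 (1 / 4)) /
    besselIntegral b 0 (1 / 4), ?_, ?_⟩
  · rw [abs_div, abs_of_pos hB, div_mul_eq_mul_div]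
    gcongr
    refine (abs_besselIntegral_sub_zero_left_le hb (by norm_num) (by positivity)).trans ?_
    rw [hτ]
    exact h _ (by positivity) ht
  · rw [greenKernel_eq_rpow_mul n k α hxy, greenConst_eq n k hn]
    simp only [← hb_def]
    field_simp
    ring

theorem norm_iteratedFDeriv_greenKernel_le (n k : ℕ) (hn : 2 * k < n) (l : ℕ) (hl : 1 ≤ l) :
    ∃ C : ℝ, 0 < C ∧ ∀ α : ℝ, 0 < α → ∀ x y : EuclideanSpace ℝ (Fin n), x ≠ y →
      √α * ‖x - y‖ ≤ 1 →
      ‖iteratedFDeriv ℝ l (fun z => ‖x - z‖ ^ ((n : ℝ) - 2 * k) * greenKernel n k α x z) y‖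
        ≤ C * ‖x - y‖ ^ (-(l : ℝ)) * greenEta n k (√α * ‖x - y‖) := by
  have hn' : (2 * k : ℝ) < n := by exact_mod_cast hn
  have hb : (k : ℝ) - 1 - n / 2 < -1 := by linarith
  obtain ⟨C, hC, h⟩ := besselDefect_le_greenEta n k hn (q := 1 / 4) (by norm_num)
  set b := (k : ℝ) - 1 - n / 2 with hb_def
  refine ⟨heatConst n k * (Nat.factorial l * (Nat.factorial l * C) * 4 ^ l),
    mul_pos (heatConst_pos n k) (by positivity), fun α hα x y hxy ht => ?_⟩
  have hr : 0 < ‖x - y‖ := norm_pos_iff.2 (sub_ne_zero.2 hxy)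
  have hτ : α * ‖x - y‖ ^ 2 = (√α * ‖x - y‖) ^ 2 := by rw [mul_pow, sq_sqrt hα.le]
  set D := besselDefect b (1 / 4) (α * ‖x - y‖ ^ 2)
  have hD : D ≤ C * greenEta n k (√α * ‖x - y‖) := by
    simp only [D]; rw [hτ]; exact h _ (by positivity) ht
  -- The value at $\tau=0$ is subtracted from the zeroth member only: the chain-rule bound includes
  -- $i=0$, so that term must be small too, and the constant does not affect derivatives of order
  -- $l\ge1$.
  set F : ℕ → ℝ → ℝ := fun j u =>
    (-α) ^ j * besselIntegral (b + j) (α * u) (1 / 4) -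
      if j = 0 then besselIntegral b 0 (1 / 4) else 0 with hF_def
  have hF : ∀ j : ℕ, ∀ u ∈ Ioi (0 : ℝ), HasDerivAt (F j) (F (j + 1) u) u := by
    intro j u (hu : 0 < u)
    have h1 := (hasDerivAt_besselIntegral_left (b + j) (mul_pos hα hu)
      (by norm_num : (0 : ℝ) < 1 / 4)).comp u ((hasDerivAt_id u).const_mul α)
    refine ((h1.const_mul ((-α) ^ j)).sub_const _).congr_deriv ?_
    simp only [F]
    rw [if_neg (Nat.succ_ne_zero j)]
    push_cast
    rw [← add_assoc]
    ring
  set T : EuclideanSpace ℝ (Fin n) →L[ℝ] EuclideanSpace ℝ (Fin n) :=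
    -ContinuousLinearMap.id ℝ _ with hT_def
  have hTz : ∀ z, x + T z = x - z := fun z => by simp [T, sub_eq_add_neg]
  have hT : ‖T‖ ≤ 2 := by
    rw [hT_def, norm_neg]; exact ContinuousLinearMap.norm_id_le.trans (by norm_num)
  have hbound := norm_iteratedFDeriv_comp_normSq_le T hT x y (by rw [hTz]; exact sub_ne_zero.2 hxy)
    hF l (C := Nat.factorial l * D) (by
      intro i hi
      rw [hTz]
      simp only [F]
      rcases Nat.eq_zero_or_pos i with rfl | hi0
      · have h1 : (1 : ℝ) ≤ Nat.factorial l := by exact_mod_cast Nat.factorial_pos l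
        have h2 := abs_besselIntegral_sub_zero_left_le hb (q := 1 / 4) (by norm_num)
          (by positivity : 0 < α * ‖x - y‖ ^ 2)
        simp only [pow_zero, one_mul, Nat.cast_zero, add_zero, if_true]
        exact h2.trans (le_mul_of_one_le_left ((abs_nonneg _).trans h2) h1)
      · rw [if_neg hi0.ne', sub_zero, abs_mul, abs_pow, abs_neg, abs_of_pos hα,
          abs_of_nonneg (besselIntegral_nonneg _ _ _), ← mul_assoc, ← mul_pow,
          mul_comm (‖x - y‖ ^ 2)]
        have h2 := pow_mul_besselIntegral_le hb (q := 1 / 4) (by norm_num)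
          (by positivity : 0 < α * ‖x - y‖ ^ 2) i hi0
        refine h2.trans ?_
        have h3 : 0 ≤ D := (abs_nonneg _).trans
          (abs_besselIntegral_sub_zero_left_le hb (by norm_num) (by positivity))
        gcongr)
  simp only [hTz] at hbound
  have hev : (fun z => ‖x - z‖ ^ ((n : ℝ) - 2 * k) * greenKernel n k α x z) =ᶠ[nhds y]
      (heatConst n k • fun z => F 0 (‖x - z‖ ^ 2)) +
        fun _ => heatConst n k * besselIntegral b 0 (1 / 4) := by
    filter_upwards [isOpen_ne.mem_nhds hxy.symm] with z (hz : z ≠ x)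
    have hrz : 0 < ‖x - z‖ := norm_pos_iff.2 (sub_ne_zero.2 hz.symm)
    rw [greenKernel_eq_rpow_mul n k α hz.symm, ← mul_assoc, ← rpow_add hrz]
    simp only [F, Pi.add_apply, Pi.smul_apply, smul_eq_mul]
    rw [show (n : ℝ) - 2 * k + (2 * k - n) = 0 by ring, rpow_zero]
    simp
    ring
  have hcd : ContDiffAt ℝ l (fun z => F 0 (‖x - z‖ ^ 2)) y := by
    have h1 : ContDiffAt ℝ ∞ (F 0) (‖x - y‖ ^ 2) :=
      (contDiffOn_of_hasDerivAt_succ isOpen_Ioi hF).contDiffAt (Ioi_mem_nhds (by positivity))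
    have h2 : ContDiffAt ℝ l (fun z => ‖x - z‖ ^ 2) y :=
      ((by fun_prop : ContDiff ℝ l (fun z => x - z)).norm_sq ℝ).contDiffAt
    exact (h1.of_le (by exact_mod_cast le_top)).comp y h2
  have hcs : ContDiffAt ℝ l (heatConst n k • fun z => F 0 (‖x - z‖ ^ 2)) y :=
    hcd.const_smul (heatConst n k)
  rw [(hev.iteratedFDeriv ℝ l).eq_of_nhds, iteratedFDeriv_add_apply hcs contDiffAt_const,
    iteratedFDeriv_const_of_ne (by omega), Pi.zero_apply, add_zero,
    iteratedFDeriv_const_smul_apply hcd, norm_smul, Real.norm_of_nonneg (heatConst_pos n k).le,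
    rpow_neg hr.le, rpow_natCast]
  have hη : 0 ≤ heatConst n k := (heatConst_pos n k).le
  calc heatConst n k * ‖iteratedFDeriv ℝ l (fun z => F 0 (‖x - z‖ ^ 2)) y‖
      ≤ heatConst n k * (Nat.factorial l * (Nat.factorial l * D) * (4 / ‖x - y‖) ^ l) := by gcongr
    _ ≤ heatConst n k * (Nat.factorial l * (Nat.factorial l *
          (C * greenEta n k (√α * ‖x - y‖))) * (4 / ‖x - y‖) ^ l) := by gcongr
    _ = _ := by rw [div_pow]; ring

theorem hasDerivAt_besselIntegral_right_family (b : ℝ) {α : ℝ} (hα : 0 < α) (j : ℕ) (u : ℝ)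
    (hu : u ∈ Ioi (0 : ℝ)) :
    HasDerivAt (fun u => (-(1 / 4)) ^ j * besselIntegral (b - j) α (u / 4))
      ((-(1 / 4)) ^ (j + 1) * besselIntegral (b - (j + 1 : ℕ)) α (u / 4)) u := by
  have h1 := (hasDerivAt_besselIntegral_right (b - j) hα
    (by have : 0 < u := hu; positivity : 0 < u / 4)).comp u ((hasDerivAt_id u).div_const 4)
  refine (h1.const_mul ((-(1 / 4)) ^ j)).congr_deriv ?_
  push_cast
  rw [← sub_sub]
  ring

theorem memClassH_greenKernel (n k : ℕ) (hn : 2 * k < n) {α : ℝ} (hα : 0 < α) :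
    MemClassH n k (greenKernel n k α) := by
  have hn' : (2 * k : ℝ) < n := by exact_mod_cast hn
  have hb : (k : ℝ) - 1 - n / 2 < -1 := by linarith
  have hA := heatConst_pos n k
  set b := (k : ℝ) - 1 - n / 2 with hb_def
  set F : ℕ → ℝ → ℝ := fun j u => (-(1 / 4)) ^ j * besselIntegral (b - j) α (u / 4) with hF_def
  have hF : ∀ j : ℕ, ∀ u ∈ Ioi (0 : ℝ), HasDerivAt (F j) (F (j + 1) u) u :=
    fun j u hu => hasDerivAt_besselIntegral_right_family b hα j u hu
  have hGF : (fun p : EuclideanSpace ℝ (Fin n) × EuclideanSpace ℝ (Fin n) =>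
      greenKernel n k α p.1 p.2) = heatConst n k • fun p => F 0 (‖p.1 - p.2‖ ^ 2) := by
    ext p; simp [F, greenKernel, hb_def]
  have hcd : ContDiffOn ℝ ∞ (fun p : EuclideanSpace ℝ (Fin n) × EuclideanSpace ℝ (Fin n) =>
      F 0 (‖p.1 - p.2‖ ^ 2)) {p | p.1 ≠ p.2} := by
    refine (contDiffOn_of_hasDerivAt_succ isOpen_Ioi hF).comp
      (((by fun_prop : ContDiff ℝ ∞ (fun p : EuclideanSpace ℝ (Fin n) × EuclideanSpace ℝ (Fin n) =>
        p.1 - p.2)).norm_sq ℝ).contDiffOn) fun p hp => ?_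
    have := norm_pos_iff.2 (sub_ne_zero.2 hp)
    exact mem_Ioi.2 (by positivity)
  have hopen : IsOpen {p : EuclideanSpace ℝ (Fin n) × EuclideanSpace ℝ (Fin n) | p.1 ≠ p.2} :=
    isOpen_ne_fun continuous_fst continuous_snd
  refine ⟨?_, ⟨heatConst n k * besselIntegral b 0 (1 / 4) + 1,
    add_pos_of_nonneg_of_pos (mul_nonneg hA.le (besselIntegral_nonneg _ _ _)) one_pos,
    fun x y hxy _ => ?_⟩, fun p hp => ?_⟩
  · rw [hGF]
    have h1 : ContDiffOn ℝ ∞ (heatConst n k • fun p : EuclideanSpace ℝ (Fin n) ×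
        EuclideanSpace ℝ (Fin n) => F 0 (‖p.1 - p.2‖ ^ 2)) {p | p.1 ≠ p.2} :=
    hcd.const_smul (heatConst n k)
    exact h1.of_le (by exact_mod_cast (le_top : ((2 * k : ℕ) : ℕ∞) ≤ ⊤))
  · have hr : 0 < ‖x - y‖ := norm_pos_iff.2 (sub_ne_zero.2 hxy)
    rw [greenKernel_eq_rpow_mul n k α hxy, neg_sub, mul_comm, abs_of_nonneg
      (mul_nonneg (mul_nonneg hA.le (besselIntegral_nonneg _ _ _)) (by positivity))]
    gcongr
    have := mul_le_mul_of_nonneg_left (besselIntegral_le_zero_left (b := b) (q := 1 / 4)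
      (p := α * ‖x - y‖ ^ 2) hb (by positivity) (by norm_num)) hA.le
    linarith
  -- A derivative of order $i\le2k$ in $u=r^2$ carries a factor $r^{2i}$, and the Bessel integral
  -- decays like $r^{-2N}$; with this $N$, $2i-2N\le-2p\le-p$.
  · obtain ⟨N, hN⟩ := exists_nat_ge (p + 2 * k)
    set B : ℕ → ℝ := fun i => Nat.factorial N * 2 ^ N * besselIntegral (b - i + N) α (1 / 4 / 2)
    have hB : ∀ i, 0 ≤ B i := fun i => mul_nonneg (by positivity) (besselIntegral_nonneg _ _ _)
    set S := ∑ i ∈ Finset.range (2 * k + 1), B i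
    have hS : 0 ≤ S := Finset.sum_nonneg fun i _ => hB i
    set T : EuclideanSpace ℝ (Fin n) × EuclideanSpace ℝ (Fin n) →L[ℝ] EuclideanSpace ℝ (Fin n) :=
      ContinuousLinearMap.fst ℝ _ _ - ContinuousLinearMap.snd ℝ _ _ with hT_def
    have hTz : ∀ z, 0 + T z = z.1 - z.2 := fun z => by simp [T]
    have hT : ‖T‖ ≤ 2 := by
      refine (norm_sub_le _ _).trans ?_
      linarith [ContinuousLinearMap.norm_fst_le ℝ (EuclideanSpace ℝ (Fin n))
        (EuclideanSpace ℝ (Fin n)), ContinuousLinearMap.norm_snd_le ℝ (EuclideanSpace ℝ (Fin n))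
        (EuclideanSpace ℝ (Fin n))]
    refine ⟨heatConst n k * (Nat.factorial (2 * k) * (4 ^ N * S) * 4 ^ (2 * k)) + 1, by positivity,
      fun l hl x y hxy => ?_⟩
    have hr : 0 < ‖x - y‖ := zero_lt_one.trans_le hxy
    have hne : x ≠ y := sub_ne_zero.1 (norm_pos_iff.1 hr)
    have hbound := norm_iteratedFDeriv_comp_normSq_le T hT 0 (x, y)
      (by rw [hTz]; exact sub_ne_zero.2 hne) hF l
      (C := 4 ^ N * S * ‖x - y‖ ^ (-p)) (by
        intro i hi
        rw [hTz]
        simp only [F]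
        have h1 := besselIntegral_le_pow_inv (b - i) hα (by norm_num : (0 : ℝ) < 1 / 4)
          (by gcongr; exact one_le_pow₀ hxy : 1 / 4 ≤ ‖x - y‖ ^ 2 / 4) N
        rw [abs_mul, abs_pow, abs_neg, abs_of_pos (by norm_num : (0 : ℝ) < 1 / 4),
          abs_of_nonneg (besselIntegral_nonneg _ _ _)]
        have h2 : (1 / 4 : ℝ) ^ i ≤ 1 := pow_le_one₀ (by norm_num) (by norm_num)
        have h3 : B i ≤ S := Finset.single_le_sum (f := B) (fun i _ => hB i)
          (Finset.mem_range.2 (by omega))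
        have h4 : (‖x - y‖ ^ 2) ^ i * ((‖x - y‖ ^ 2) ^ N)⁻¹ ≤ ‖x - y‖ ^ (-p) := by
          rw [← pow_mul, ← pow_mul, ← rpow_natCast, ← rpow_natCast, ← rpow_neg hr.le,
            ← rpow_add hr]
          refine rpow_le_rpow_of_exponent_le hxy ?_
          have : (i : ℝ) ≤ 2 * k := by exact_mod_cast hi.trans hl
          have : (0 : ℝ) ≤ k := Nat.cast_nonneg k
          push_cast
          linarith
        calc (‖x - y‖ ^ 2) ^ i * ((1 / 4) ^ i * besselIntegral (b - i) α (‖x - y‖ ^ 2 / 4))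
            ≤ (‖x - y‖ ^ 2) ^ i * (1 * (B i * ((‖x - y‖ ^ 2 / 4) ^ N)⁻¹)) := by
              gcongr
              · exact besselIntegral_nonneg _ _ _
          _ = B i * 4 ^ N * ((‖x - y‖ ^ 2) ^ i * ((‖x - y‖ ^ 2) ^ N)⁻¹) := by
              rw [div_pow, inv_div]; ring
          _ ≤ S * 4 ^ N * ‖x - y‖ ^ (-p) := by gcongr
          _ = _ := by ring)
    simp only [hTz] at hbound
    have hcd' : ContDiffAt ℝ l (fun p : EuclideanSpace ℝ (Fin n) × EuclideanSpace ℝ (Fin n) =>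
        F 0 (‖p.1 - p.2‖ ^ 2)) (x, y) :=
      (hcd.contDiffAt (hopen.mem_nhds hne)).of_le (by exact_mod_cast le_top)
    rw [hGF, iteratedFDeriv_const_smul_apply hcd', norm_smul, Real.norm_of_nonneg hA.le]
    have h4 : (4 / ‖x - y‖) ^ l ≤ 4 ^ (2 * k) := by
      calc (4 / ‖x - y‖) ^ l ≤ 4 ^ l := by
            gcongr; exact div_le_self (by norm_num) hxy
        _ ≤ 4 ^ (2 * k) := pow_le_pow_right₀ (by norm_num) hl
    have h5 : (Nat.factorial l : ℝ) ≤ Nat.factorial (2 * k) := by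
      exact_mod_cast Nat.factorial_le hl
    calc heatConst n k * ‖iteratedFDeriv ℝ l (fun p : EuclideanSpace ℝ (Fin n) ×
          EuclideanSpace ℝ (Fin n) => F 0 (‖p.1 - p.2‖ ^ 2)) (x, y)‖
        ≤ heatConst n k * (Nat.factorial l * (4 ^ N * S * ‖x - y‖ ^ (-p)) *
            (4 / ‖x - y‖) ^ l) := by gcongr
      _ ≤ heatConst n k * (Nat.factorial (2 * k) * (4 ^ N * S * ‖x - y‖ ^ (-p)) *
            4 ^ (2 * k)) := by gcongr
      _ = heatConst n k * (Nat.factorial (2 * k) * (4 ^ N * S) * 4 ^ (2 * k)) *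
            ‖x - y‖ ^ (-p) := by ring
      _ ≤ _ := by gcongr; linarith

/-! ### The kernel is a fundamental solution, via the Fourier transform. -/

section ShiftedLaplacian

variable {n : ℕ}

theorem laplacian_eq_sum_fderiv_fderiv {f : EuclideanSpace ℝ (Fin n) → ℝ} :
    Laplacian.laplacian f = fun y => ∑ i : Fin n, fderiv ℝ (fderiv ℝ f) y
      (EuclideanSpace.basisFun (Fin n) ℝ i) (EuclideanSpace.basisFun (Fin n) ℝ i) := by
  rw [InnerProductSpace.laplacian_eq_iteratedFDeriv_orthonormalBasis f
    (EuclideanSpace.basisFun (Fin n) ℝ)]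
  ext y
  refine Finset.sum_congr rfl fun i _ => ?_
  rw [iteratedFDeriv_two_apply]
  simp

theorem contDiff_shiftedLaplacian (α : ℝ) {f : EuclideanSpace ℝ (Fin n) → ℝ}
    (hf : ContDiff ℝ ∞ f) : ContDiff ℝ ∞ (shiftedLaplacian n α f) := by
  have h1 : ContDiff ℝ ∞ (fderiv ℝ f) := hf.fderiv_right (by simp)
  have h2 : ContDiff ℝ ∞ (fderiv ℝ (fderiv ℝ f)) := h1.fderiv_right (by simp)
  unfold shiftedLaplacian
  rw [laplacian_eq_sum_fderiv_fderiv]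
  fun_prop

theorem contDiff_iterate_shiftedLaplacian (α : ℝ) (k : ℕ) {f : EuclideanSpace ℝ (Fin n) → ℝ}
    (hf : ContDiff ℝ ∞ f) : ContDiff ℝ ∞ ((shiftedLaplacian n α)^[k] f) := by
  induction k with
  | zero => exact hf
  | succ k ih => rw [Function.iterate_succ_apply']; exact contDiff_shiftedLaplacian α ih

end ShiftedLaplacian

section FourierSide

open scoped FourierTransform SchwartzMap Laplacian

theorem fourier_laplacian_apply {E : Type*} [NormedAddCommGroup E] [InnerProductSpace ℝ E]
    [FiniteDimensional ℝ E] [MeasurableSpace E] [BorelSpace E] (f : 𝓢(E, ℂ)) (ξ : E) :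
    𝓕 (Δ f) ξ = -((2 * π * ‖ξ‖) ^ 2 : ℝ) * 𝓕 f ξ := by
  have hg : Function.HasTemperateGrowth (fun x : E => ‖x‖ ^ 2) := by fun_prop
  rw [SchwartzMap.laplacian_eq_fourierMultiplierCLM, FourierTransform.fourier_smul,
    SchwartzMap.fourierMultiplierCLM_apply, FourierTransform.fourier_fourierInv_eq]
  rw [smul_apply]
  have := SchwartzMap.smulLeftCLM_apply_apply (F := ℂ) hg (𝓕 f) ξ
  erw [this]
  simp
  ring

variable {n : ℕ}

/-- The operator `Δ_ξ + α` on complex Schwartz functions. -/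
noncomputable def schwartzShiftedLaplacian (α : ℝ) (f : 𝓢(EuclideanSpace ℝ (Fin n), ℂ)) :
    𝓢(EuclideanSpace ℝ (Fin n), ℂ) :=
  -(Δ f) + (α : ℂ) • f

theorem iterate_schwartzShiftedLaplacian_apply (α : ℝ) (k : ℕ)
    {φ : EuclideanSpace ℝ (Fin n) → ℝ} (hφ : ContDiff ℝ ∞ φ)
    (f : 𝓢(EuclideanSpace ℝ (Fin n), ℂ)) (hf : ∀ y, f y = (φ y : ℂ)) (y) :
    (schwartzShiftedLaplacian α)^[k] f y = (((shiftedLaplacian n α)^[k] φ y : ℝ) : ℂ) := by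
  induction k generalizing y with
  | zero => exact hf y
  | succ k ih =>
    rw [Function.iterate_succ_apply', Function.iterate_succ_apply']
    have hg := contDiff_iterate_shiftedLaplacian α k hφ
    set g := (shiftedLaplacian n α)^[k] φ
    set F := (schwartzShiftedLaplacian α)^[k] f
    have hF : (F : EuclideanSpace ℝ (Fin n) → ℂ) = Complex.ofRealCLM ∘ g := by
      ext z; exact ih z
    have h1 : ContDiffAt ℝ 2 g y := (contDiff_infty.1 hg 2).contDiffAt
    rw [schwartzShiftedLaplacian, add_apply, neg_apply, smul_apply, SchwartzMap.laplacian_apply,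
      hF, h1.laplacian_CLM_comp_left, shiftedLaplacian]
    simp

theorem fourier_iterate_schwartzShiftedLaplacian (α : ℝ) (k : ℕ)
    (f : 𝓢(EuclideanSpace ℝ (Fin n), ℂ)) (ξ : EuclideanSpace ℝ (Fin n)) :
    𝓕 ((schwartzShiftedLaplacian α)^[k] f) ξ = (((2 * π * ‖ξ‖) ^ 2 + α) ^ k : ℝ) * 𝓕 f ξ := by
  induction k with
  | zero => simp
  | succ k ih =>
    rw [Function.iterate_succ_apply', schwartzShiftedLaplacian, FourierTransform.fourier_add,
      FourierTransform.fourier_neg, FourierTransform.fourier_smul, add_apply, neg_apply, smul_apply,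
      fourier_laplacian_apply, ih]
    simp
    ring

/-- The heat kernel centred at $x$ is the Fourier transform of a Gaussian times a character, so this
is the multiplication formula $\int\hat g f=\int g\hat f$. -/
theorem integral_heatKernel_mul_eq (f : 𝓢(EuclideanSpace ℝ (Fin n), ℂ))
    (x : EuclideanSpace ℝ (Fin n)) {s : ℝ} (hs : 0 < s) :
    ∫ y, ((((4 * π * s) ^ ((n : ℝ) / 2))⁻¹ * exp (-(‖x - y‖ ^ 2 / 4 / s)) : ℝ) : ℂ) * f y =
      ∫ ξ, Complex.exp (-(4 * π ^ 2 * s : ℝ) * ‖ξ‖ ^ 2 + 2 * π * Complex.I * inner ℝ x ξ) *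
        𝓕 f ξ := by
  have hb : 0 < (((4 * π ^ 2 * s : ℝ) : ℂ)).re := by rw [Complex.ofReal_re]; positivity
  have J : Integrable (fun ξ : EuclideanSpace ℝ (Fin n) => Complex.exp
      (-(4 * π ^ 2 * s : ℝ) * ‖ξ‖ ^ 2 + 2 * π * Complex.I * inner ℝ x ξ)) :=
    GaussianFourier.integrable_cexp_neg_mul_sq_norm_add hb _ _
  have h := VectorFourier.integral_fourierIntegral_smul_eq_flip (L := innerₗ _)
      Real.continuous_fourierChar continuous_inner J (f.integrable (μ := volume))
  have h2 : ∀ y, ((((4 * π * s) ^ ((n : ℝ) / 2))⁻¹ * exp (-(‖x - y‖ ^ 2 / 4 / s)) : ℝ) : ℂ) =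
      𝓕 (fun ξ : EuclideanSpace ℝ (Fin n) => Complex.exp
        (-(4 * π ^ 2 * s : ℝ) * ‖ξ‖ ^ 2 + 2 * π * Complex.I * inner ℝ x ξ)) y := by
    intro y
    rw [fourier_gaussian_innerProductSpace' hb x y, finrank_euclideanSpace_fin]
    rw [Complex.ofReal_mul, Complex.ofReal_exp, ← inv_rpow (by positivity),
      Complex.ofReal_cpow (by positivity)]
    congr 2
    · push_cast
      have : (π : ℂ) ≠ 0 := by exact_mod_cast pi_ne_zero
      have : (s : ℂ) ≠ 0 := by exact_mod_cast hs.ne'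
      field_simp
    · push_cast; rfl
    · push_cast
      have : (π : ℂ) ≠ 0 := by exact_mod_cast pi_ne_zero
      have : (s : ℂ) ≠ 0 := by exact_mod_cast hs.ne'
      field_simp
  simp_rw [h2]
  simpa using! h

end FourierSide

section Existence

variable {n : ℕ}

theorem integral_exp_neg_normSq_div (x : EuclideanSpace ℝ (Fin n)) {s : ℝ} (hs : 0 < s) :
    ∫ y, exp (-(‖x - y‖ ^ 2 / 4 / s)) = (4 * π * s) ^ ((n : ℝ) / 2) := by
  rw [integral_sub_left_eq_self (fun y : EuclideanSpace ℝ (Fin n) => exp (-(‖y‖ ^ 2 / 4 / s)))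
    volume x]
  have h := GaussianFourier.integral_rexp_neg_mul_sq_norm (V := EuclideanSpace ℝ (Fin n))
    (b := 1 / (4 * s)) (by positivity)
  rw [finrank_euclideanSpace_fin] at h
  rw [show 4 * π * s = π / (1 / (4 * s)) by field_simp, ← h]
  congr 1 with y
  congr 1
  field_simp

theorem integrable_exp_neg_normSq_div (x : EuclideanSpace ℝ (Fin n)) {s : ℝ} (hs : 0 < s) :
    Integrable fun y => exp (-(‖x - y‖ ^ 2 / 4 / s)) :=
  .of_integral_ne_zero (by rw [integral_exp_neg_normSq_div x hs]; positivity)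

/-- Integrating in $y$ first gives $(4\pi s)^{n/2}$, which cancels $s^{-n/2}$ and leaves the Gamma
integrand $s^{k-1}e^{-\alpha s}$. -/
theorem integrable_prod_greenIntegrand (k : ℕ) (hk : 1 ≤ k) {α : ℝ} (hα : 0 < α)
    (x : EuclideanSpace ℝ (Fin n)) :
    Integrable (fun p : ℝ × EuclideanSpace ℝ (Fin n) =>
      p.1 ^ ((k : ℝ) - 1 - n / 2) * exp (-(α * p.1) - ‖x - p.2‖ ^ 2 / 4 / p.1))
      ((volume.restrict (Ioi 0)).prod volume) := by
  have hmeas : Measurable (fun p : ℝ × EuclideanSpace ℝ (Fin n) =>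
      p.1 ^ ((k : ℝ) - 1 - n / 2) * exp (-(α * p.1) - ‖x - p.2‖ ^ 2 / 4 / p.1)) := by
    fun_prop
  have hsplit : ∀ s : ℝ, ∀ y : EuclideanSpace ℝ (Fin n),
      exp (-(α * s) - ‖x - y‖ ^ 2 / 4 / s) = exp (-(α * s)) * exp (-(‖x - y‖ ^ 2 / 4 / s)) :=
    fun s y => by rw [← exp_add]; ring_nf
  rw [integrable_prod_iff hmeas.aestronglyMeasurable]
  refine ⟨(ae_restrict_iff' measurableSet_Ioi).2 (ae_of_all _ fun s (hs : 0 < s) => ?_), ?_⟩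
  · simp_rw [hsplit]
    exact ((integrable_exp_neg_normSq_div x hs).const_mul _).const_mul _
  · have hk' : (1 : ℝ) ≤ k := by exact_mod_cast hk
    have h := (integrableOn_rpow_mul_exp_neg_mul_rpow (p := 1) (s := (k : ℝ) - 1) (b := α)
      (by linarith) one_pos hα).const_mul ((4 * π) ^ ((n : ℝ) / 2))
    refine h.congr ((ae_restrict_iff' measurableSet_Ioi).2 (ae_of_all _ fun s (hs : 0 < s) => ?_))
    simp only
    have : ∀ y : EuclideanSpace ℝ (Fin n), ‖s ^ ((k : ℝ) - 1 - n / 2) *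
        exp (-(α * s) - ‖x - y‖ ^ 2 / 4 / s)‖ = s ^ ((k : ℝ) - 1 - n / 2) * exp (-(α * s)) *
          exp (-(‖x - y‖ ^ 2 / 4 / s)) := fun y => by
      rw [Real.norm_of_nonneg (by positivity), hsplit, mul_assoc]
    simp_rw [this]
    have e : s ^ ((k : ℝ) - 1 - n / 2) * s ^ ((n : ℝ) / 2) = s ^ ((k : ℝ) - 1) := by
      rw [← rpow_add hs]; ring_nf
    rw [integral_const_mul, integral_exp_neg_normSq_div x hs, mul_rpow (by positivity) hs.le,
      rpow_one, neg_mul, ← e]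
    ring

theorem integrable_greenKernel (k : ℕ) (hk : 1 ≤ k) {α : ℝ} (hα : 0 < α)
    (x : EuclideanSpace ℝ (Fin n)) : Integrable (greenKernel n k α x) :=
  (integrable_prod_greenIntegrand k hk hα x).integral_prod_right.const_mul _

open scoped FourierTransform in
theorem isFundamentalSolution_greenKernel (k : ℕ) (hk : 1 ≤ k) {α : ℝ} (hα : 0 < α) :
    IsFundamentalSolution n k α (greenKernel n k α) := by
  refine fun x => ⟨(integrable_greenKernel k hk hα x).locallyIntegrable, fun φ hφ hφc => ?_⟩
  have hk' : (1 : ℝ) ≤ k := by exact_mod_cast hk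
  have hΦc : HasCompactSupport fun y => (φ y : ℂ) := hφc.comp_left Complex.ofReal_zero
  set f := hΦc.toSchwartzMap (Complex.ofRealCLM.contDiff.comp hφ) with hf_def
  have hf : ∀ y, f y = (φ y : ℂ) := fun y => rfl
  set ψ := (schwartzShiftedLaplacian α)^[k] f
  have hψ := iterate_schwartzShiftedLaplacian_apply α k hφ f hf
  have hFψ := fourier_iterate_schwartzShiftedLaplacian α k f
  set b : ℝ := (k : ℝ) - 1 - n / 2 with hb_def
  set P : ℝ → EuclideanSpace ℝ (Fin n) → ℝ :=
    fun s y => s ^ b * exp (-(α * s) - ‖x - y‖ ^ 2 / 4 / s)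
  set Cn : ℝ := (4 * π) ^ ((n : ℝ) / 2) with hCn
  have hCn0 : 0 < Cn := by positivity
  set g : EuclideanSpace ℝ (Fin n) → ℝ → ℂ := fun ξ s =>
    Complex.exp (-(4 * π ^ 2 * s : ℝ) * ‖ξ‖ ^ 2 + 2 * π * Complex.I * inner ℝ x ξ)
  -- Fubini on the physical side
  have hP : Integrable (Function.uncurry fun s y => (P s y : ℂ) * ψ y)
      ((volume.restrict (Ioi 0)).prod volume) := by
    refine Integrable.mul_bdd (c := ‖ψ.toBoundedContinuousFunction‖) (integrable_prod_greenIntegrand k hk hα x).ofReal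
      (ψ.continuous.comp continuous_snd).aestronglyMeasurable (ae_of_all _ fun p => ?_)
    exact ψ.toBoundedContinuousFunction.norm_coe_le_norm p.2
  -- Fubini on the frequency side
  have hQ : Integrable (Function.uncurry fun (s : ℝ) (ξ : EuclideanSpace ℝ (Fin n)) =>
      ((s ^ ((k : ℝ) - 1) * exp (-(α * s)) : ℝ) : ℂ) * (g ξ s * 𝓕 ψ ξ))
      ((volume.restrict (Ioi 0)).prod volume) := by
    have h1 : IntegrableOn (fun s : ℝ => s ^ ((k : ℝ) - 1) * exp (-(α * s))) (Ioi 0) := by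
      have := integrableOn_rpow_mul_exp_neg_mul_rpow (p := 1) (s := (k : ℝ) - 1) (b := α)
        (by linarith) one_pos hα
      simpa using this
    have h2 := (Integrable.ofReal (𝕜 := ℂ) h1).mul_prod ((𝓕 ψ).integrable (μ := volume))
    refine h2.mono ?_ ?_
    · have : Continuous fun ξ => 𝓕 ψ ξ := (𝓕 ψ).continuous
      simp only [g, Function.uncurry_def]
      fun_prop
    · have hae : ∀ᵐ p : ℝ × EuclideanSpace ℝ (Fin n) ∂((volume.restrict (Ioi 0)).prod volume),
          0 < p.1 := by
        have : ∀ᵐ s : ℝ ∂(volume.restrict (Ioi (0 : ℝ))), 0 < s :=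
          (ae_restrict_iff' measurableSet_Ioi).2 (ae_of_all _ fun s hs => hs)
        exact Measure.quasiMeasurePreserving_fst.ae this
      filter_upwards [hae] with p hp
      have hg : ‖g p.2 p.1‖ ≤ 1 := by
        simp only [g]
        rw [Complex.norm_exp]
        refine Real.exp_le_one_iff.2 ?_
        have : 0 ≤ 4 * π ^ 2 * p.1 * ‖p.2‖ ^ 2 := by positivity
        have e : (-((4 * π ^ 2 * p.1 : ℝ) : ℂ) * (‖p.2‖ : ℂ) ^ 2 +
            2 * π * Complex.I * ((inner ℝ x p.2 : ℝ) : ℂ)) =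
            ((-(4 * π ^ 2 * p.1 * ‖p.2‖ ^ 2) : ℝ) : ℂ) +
              ((2 * π * inner ℝ x p.2 : ℝ) : ℂ) * Complex.I := by
          push_cast; ring
        rw [e, Complex.add_re, Complex.ofReal_re, Complex.re_ofReal_mul, Complex.I_re]
        linarith
      simp only [Function.uncurry_def, norm_mul]
      exact mul_le_mul_of_nonneg_left (mul_le_of_le_one_left (norm_nonneg _) hg) (norm_nonneg _)
  have hinner : ∀ s : ℝ, 0 < s → ∫ y, (P s y : ℂ) * ψ y =
      (Cn : ℂ) * ∫ ξ, ((s ^ ((k : ℝ) - 1) * exp (-(α * s)) : ℝ) : ℂ) * (g ξ s * 𝓕 ψ ξ) := by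
    intro s hs
    rw [integral_const_mul, ← integral_heatKernel_mul_eq ψ x hs, ← integral_const_mul,
      ← integral_const_mul]
    congr 1 with y
    rw [← mul_assoc, ← mul_assoc, ← Complex.ofReal_mul, ← Complex.ofReal_mul]
    congr 2
    simp only [P]
    have e : s ^ ((k : ℝ) - 1) = s ^ b * s ^ ((n : ℝ) / 2) := by
      rw [← rpow_add hs, hb_def]; ring_nf
    have := rpow_pos_of_pos hs ((n : ℝ) / 2)
    rw [mul_rpow (by positivity) hs.le, ← hCn, e, sub_eq_add_neg, exp_add]
    field_simp
  -- With $\lambda=|2\pi\xi|^2+\alpha$, the $s$-integral is $(k-1)!\,\lambda^{-k}$, and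
  -- $\lambda^{-k}$ cancels the symbol $\lambda^k$ in the transform of `ψ`. Only Fourier inversion
  -- for `f` remains.
  have hsint : ∀ ξ : EuclideanSpace ℝ (Fin n),
      ∫ s in Ioi (0 : ℝ), ((s ^ ((k : ℝ) - 1) * exp (-(α * s)) : ℝ) : ℂ) * (g ξ s * 𝓕 ψ ξ) =
      (Nat.factorial (k - 1) : ℂ) *
        (Complex.exp (2 * π * inner ℝ x ξ * Complex.I) * 𝓕 f ξ) := by
    intro ξ
    set lam : ℝ := (2 * π * ‖ξ‖) ^ 2 + α
    have hlam : 0 < lam := by positivity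
    have e : ∀ s : ℝ, ((s ^ ((k : ℝ) - 1) * exp (-(α * s)) : ℝ) : ℂ) * (g ξ s * 𝓕 ψ ξ) =
        ((s ^ ((k : ℝ) - 1) * exp (-(lam * s)) : ℝ) : ℂ) *
          (Complex.exp (2 * π * inner ℝ x ξ * Complex.I) * 𝓕 ψ ξ) := by
      intro s
      have e1 : g ξ s = ((exp (-((2 * π * ‖ξ‖) ^ 2 * s)) : ℝ) : ℂ) *
          Complex.exp (2 * π * inner ℝ x ξ * Complex.I) := by
        simp only [g]
        rw [Complex.ofReal_exp, ← Complex.exp_add]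
        congr 1
        push_cast
        ring
      have e2 : exp (-(lam * s)) = exp (-(α * s)) * exp (-((2 * π * ‖ξ‖) ^ 2 * s)) := by
        rw [← exp_add]; congr 1; simp only [lam]; ring
      rw [e1, e2]
      push_cast
      ring
    simp_rw [e]
    rw [integral_mul_const, integral_complex_ofReal,
      Real.integral_rpow_mul_exp_neg_mul_Ioi (by linarith) hlam, hFψ ξ]
    have e3 : Real.Gamma k = Nat.factorial (k - 1) := by
      obtain ⟨j, rfl⟩ := Nat.exists_eq_add_of_le' hk
      rw [Nat.add_sub_cancel, ← Real.Gamma_nat_eq_factorial]; push_cast; rfl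
    rw [e3, rpow_natCast, one_div, inv_pow, show (2 * π * ‖ξ‖) ^ 2 + α = lam from rfl]
    have : (lam : ℂ) ≠ 0 := by exact_mod_cast hlam.ne'
    push_cast
    field_simp
  have hinv : ∫ ξ, Complex.exp (2 * π * inner ℝ x ξ * Complex.I) * 𝓕 f ξ = φ x := by
    have h1 : 𝓕⁻ (𝓕 f) x = f x := by rw [FourierTransform.fourierInv_fourier_eq]
    rw [SchwartzMap.fourierInv_coe, fourierInv_eq'] at h1
    rw [← hf x, ← h1]
    congr 1 with ξ
    rw [smul_eq_mul, real_inner_comm]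
    push_cast
    rfl
  have key : ∫ y, ((greenKernel n k α x y * (shiftedLaplacian n α)^[k] φ y : ℝ) : ℂ) = φ x := by
    have e1 : ∀ y, ((greenKernel n k α x y * (shiftedLaplacian n α)^[k] φ y : ℝ) : ℂ) =
        (heatConst n k : ℂ) * ∫ s in Ioi (0 : ℝ), (P s y : ℂ) * ψ y := by
      intro y
      rw [integral_mul_const, integral_complex_ofReal, hψ y, Complex.ofReal_mul, greenKernel,
        Complex.ofReal_mul, mul_assoc]
      rfl
    simp_rw [e1]
    rw [integral_const_mul, ← integral_integral_swap hP,
      setIntegral_congr_fun measurableSet_Ioi hinner, integral_const_mul,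
      integral_integral_swap hQ]
    simp_rw [hsint]
    rw [integral_const_mul, hinv, heatConst, ← hCn]
    have h1 : (Cn : ℂ) ≠ 0 := by exact_mod_cast hCn0.ne'
    have h2 : (Nat.factorial (k - 1) : ℂ) ≠ 0 := by exact_mod_cast Nat.factorial_ne_zero _
    push_cast
    field_simp
  rw [integral_complex_ofReal] at key
  exact_mod_cast key

end Existence

/-! ### Uniqueness: cutoffs, plane waves, injectivity of the Fourier transform. -/

section BoundedDerivatives

variable {n : ℕ}

theorem norm_iteratedFDeriv_comp_clm_le {V W : Type*} [NormedAddCommGroup V] [NormedSpace ℝ V]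
    [NormedAddCommGroup W] [NormedSpace ℝ W] (A : V →L[ℝ] W) {g : W → ℝ} (hg : ContDiff ℝ ∞ g)
    (i : ℕ) (y : V) :
    ‖iteratedFDeriv ℝ i (fun z => g (A z)) y‖ ≤ ‖iteratedFDeriv ℝ i g (A y)‖ * ‖A‖ ^ i := by
  have h := A.iteratedFDeriv_comp_right hg y (i := i) (by exact_mod_cast le_top)
  have h2 := (iteratedFDeriv ℝ i g (A y)).norm_compContinuousLinearMap_le fun _ => A
  rw [← h] at h2
  simpa [Function.comp_def] using h2

set_option maxSynthPendingDepth 3 in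
theorem exists_bound_sum_fderiv_fderiv {V ι : Type*} [NormedAddCommGroup V] [NormedSpace ℝ V]
    [Fintype ι] (b : ι → V) :
    ∃ K : ℝ, 0 ≤ K ∧ ∀ f : V → ℝ, ContDiff ℝ ∞ f → ∀ (i : ℕ) (y : V),
      ‖iteratedFDeriv ℝ i (fun y => ∑ j, fderiv ℝ (fderiv ℝ f) y (b j) (b j)) y‖ ≤
        K * ‖iteratedFDeriv ℝ (i + 2) f y‖ := by
  set S : (V →L[ℝ] V →L[ℝ] ℝ) →L[ℝ] ℝ :=
    ∑ j, (ContinuousLinearMap.apply ℝ ℝ (b j)).comp (ContinuousLinearMap.apply ℝ _ (b j))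
  refine ⟨‖S‖, norm_nonneg S, fun f hf i y => ?_⟩
  have h1 : ContDiff ℝ ∞ (fderiv ℝ f) := hf.fderiv_right (by simp)
  have h2 : ContDiff ℝ ∞ (fderiv ℝ (fderiv ℝ f)) := h1.fderiv_right (by simp)
  have h5 := S.norm_iteratedFDeriv_comp_left (contDiff_infty.1 h2 i).contDiffAt (x := y) le_rfl
  rw [norm_iteratedFDeriv_fderiv, norm_iteratedFDeriv_fderiv] at h5
  have e : (fun y => ∑ j, fderiv ℝ (fderiv ℝ f) y (b j) (b j)) = S ∘ fderiv ℝ (fderiv ℝ f) := by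
    ext z; simp [S]
  rw [e]
  exact h5

theorem exists_bound_shiftedLaplacian (n : ℕ) (α : ℝ) :
    ∃ K : ℝ, 0 ≤ K ∧ ∀ (f : EuclideanSpace ℝ (Fin n) → ℝ), ContDiff ℝ ∞ f → ∀ (M : ℝ) (m : ℕ),
      (∀ i ≤ m + 2, ∀ y, ‖iteratedFDeriv ℝ i f y‖ ≤ M) →
        ∀ i ≤ m, ∀ y, ‖iteratedFDeriv ℝ i (shiftedLaplacian n α f) y‖ ≤ K * M := by
  obtain ⟨K, hK, hKb⟩ := exists_bound_sum_fderiv_fderiv (EuclideanSpace.basisFun (Fin n) ℝ)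
  refine ⟨K + |α|, by positivity, fun f hf M m hM i hi y => ?_⟩
  have h1 : ContDiff ℝ ∞ (fderiv ℝ f) := hf.fderiv_right (by simp)
  have h2 : ContDiff ℝ ∞ (fderiv ℝ (fderiv ℝ f)) := h1.fderiv_right (by simp)
  set D : EuclideanSpace ℝ (Fin n) → ℝ := fun y => ∑ j : Fin n, fderiv ℝ (fderiv ℝ f) y
    (EuclideanSpace.basisFun (Fin n) ℝ j) (EuclideanSpace.basisFun (Fin n) ℝ j) with hD_def
  have hD : ContDiff ℝ ∞ D := by fun_prop
  have hS : shiftedLaplacian n α f = -D + α • f := by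
    ext z
    rw [shiftedLaplacian, laplacian_eq_sum_fderiv_fderiv]
    rfl
  have h4 : ContDiffAt ℝ i f y := (contDiff_infty.1 hf i).contDiffAt
  have h4' : ContDiffAt ℝ i (α • f) y := h4.const_smul α
  have h3 : ContDiffAt ℝ i (-D) y := (contDiff_infty.1 hD i).contDiffAt.neg
  rw [hS, iteratedFDeriv_add_apply h3 h4', iteratedFDeriv_neg_apply,
    iteratedFDeriv_const_smul_apply h4]
  refine (norm_add_le _ _).trans ?_
  rw [norm_neg, norm_smul, Real.norm_eq_abs, add_mul]
  gcongr
  · exact (hKb f hf i y).trans (by gcongr; exact hM _ (by omega) y)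
  · exact hM _ (by omega) y

/-- `K` depends on the operator alone, so it serves a whole sequence of truncated plane waves and
provides the dominating function in the limit. -/
theorem exists_bound_iterate_shiftedLaplacian (n : ℕ) (α : ℝ) (k : ℕ) :
    ∃ K : ℝ, 0 ≤ K ∧ ∀ (f : EuclideanSpace ℝ (Fin n) → ℝ), ContDiff ℝ ∞ f → ∀ M : ℝ,
      (∀ i ≤ 2 * k, ∀ y, ‖iteratedFDeriv ℝ i f y‖ ≤ M) →
        ∀ y, |(shiftedLaplacian n α)^[k] f y| ≤ K * M := by
  induction k with
  | zero =>
    refine ⟨1, zero_le_one, fun f _ M hM y => ?_⟩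
    simpa using hM 0 le_rfl y
  | succ k ih =>
    obtain ⟨K, hK, h⟩ := ih
    obtain ⟨K', hK', h'⟩ := exists_bound_shiftedLaplacian n α
    refine ⟨K * K', by positivity, fun f hf M hM y => ?_⟩
    rw [Function.iterate_succ_apply, mul_assoc]
    exact h _ (contDiff_shiftedLaplacian α hf) _ (h' f hf M (2 * k) hM) y

theorem iterate_shiftedLaplacian_congr (α : ℝ) (k : ℕ) {f g : EuclideanSpace ℝ (Fin n) → ℝ}
    {y : EuclideanSpace ℝ (Fin n)} (h : f =ᶠ[nhds y] g) :
    (shiftedLaplacian n α)^[k] f =ᶠ[nhds y] (shiftedLaplacian n α)^[k] g := by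
  induction k with
  | zero => exact h
  | succ k ih =>
    rw [Function.iterate_succ_apply', Function.iterate_succ_apply']
    filter_upwards [ih, InnerProductSpace.laplacian_congr_nhds ih] with z h1 h2
    rw [shiftedLaplacian, shiftedLaplacian, h1, h2]

/-- A real plane wave. -/
noncomputable def planeWave (t : EuclideanSpace ℝ (Fin n)) (θ : ℝ)
    (y : EuclideanSpace ℝ (Fin n)) : ℝ :=
  cos (inner ℝ t y + θ)

theorem contDiff_planeWave (t : EuclideanSpace ℝ (Fin n)) (θ : ℝ) :
    ContDiff ℝ ∞ (planeWave t θ) := by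
  exact contDiff_cos.comp ((innerSL ℝ t).contDiff.add contDiff_const)

theorem norm_iteratedFDeriv_planeWave_le (t : EuclideanSpace ℝ (Fin n)) (θ : ℝ) (i : ℕ)
    (y : EuclideanSpace ℝ (Fin n)) : ‖iteratedFDeriv ℝ i (planeWave t θ) y‖ ≤ ‖t‖ ^ i := by
  -- Differentiating a cosine shifts its phase by $\pi/2$, so all derivatives stay bounded by $1$.
  set F : ℕ → ℝ → ℝ := fun j u => cos (u + θ + j * (π / 2))
  have hF : ∀ j : ℕ, ∀ u ∈ (univ : Set ℝ), HasDerivAt (F j) (F (j + 1) u) u := by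
    intro j u _
    have h1 : HasDerivAt (fun u : ℝ => u + θ + j * (π / 2)) 1 u :=
      ((hasDerivAt_id u).add_const θ).add_const _
    refine h1.cos.congr_deriv ?_
    simp only [F]
    rw [show u + θ + ((j + 1 : ℕ) : ℝ) * (π / 2) = u + θ + j * (π / 2) + π / 2 by push_cast; ring,
      cos_add_pi_div_two]
    ring
  have hF0 : ContDiff ℝ ∞ (F 0) := contDiffOn_univ.1 (contDiffOn_of_hasDerivAt_succ isOpen_univ hF)
  have h := norm_iteratedFDeriv_comp_clm_le (innerSL ℝ t) hF0 i y
  have e : planeWave t θ = fun z => F 0 (innerSL ℝ t z) := by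
    ext z; simp [F, planeWave]
  rw [e]
  refine h.trans ?_
  rw [norm_iteratedFDeriv_eq_norm_iteratedDeriv,
    iteratedDeriv_eq_of_hasDerivAt_succ isOpen_univ hF i _ (mem_univ _), innerSL_apply_norm]
  exact mul_le_of_le_one_left (by positivity) (abs_cos_le_one _)

theorem shiftedLaplacian_planeWave (α : ℝ) (t : EuclideanSpace ℝ (Fin n)) (θ c : ℝ) :
    shiftedLaplacian n α (fun y => c * planeWave t θ y) =
      fun y => (c * (‖t‖ ^ 2 + α)) * planeWave t θ y := by
  have h0 : ∀ y : EuclideanSpace ℝ (Fin n), HasFDerivAt (fun y => (inner ℝ t y + θ : ℝ))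
      (innerSL ℝ t) y := fun y => ((innerSL ℝ t).hasFDerivAt).add_const θ
  have h1 : fderiv ℝ (fun y => c * planeWave t θ y) =
      fun y => (c * -sin (inner ℝ t y + θ)) • innerSL ℝ t := by
    ext1 y
    rw [mul_smul]
    exact ((h0 y).cos.const_mul c).fderiv
  have h2 : ∀ y, fderiv ℝ (fderiv ℝ (fun y => c * planeWave t θ y)) y =
      (c • -(cos (inner ℝ t y + θ) • innerSL ℝ t)).smulRight (innerSL ℝ t) := by
    intro y
    rw [h1]
    exact ((((h0 y).sin.neg).const_mul c).smul_const (innerSL ℝ t)).fderiv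
  ext y
  rw [shiftedLaplacian, laplacian_eq_sum_fderiv_fderiv]
  simp only [h2]
  have h3 := (EuclideanSpace.basisFun (Fin n) ℝ).sum_sq_inner_right t
  have h4 : ∀ i : Fin n, ((c • -(cos (inner ℝ t y + θ) • innerSL ℝ t)).smulRight (innerSL ℝ t))
      (EuclideanSpace.basisFun (Fin n) ℝ i) (EuclideanSpace.basisFun (Fin n) ℝ i) =
      -(c * cos (inner ℝ t y + θ)) * inner ℝ (EuclideanSpace.basisFun (Fin n) ℝ i) t ^ 2 := by
    intro i
    rw [real_inner_comm t (EuclideanSpace.basisFun (Fin n) ℝ i)]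
    simp only [ContinuousLinearMap.smulRight_apply, smul_apply, neg_apply, innerSL_apply_apply,
      smul_eq_mul]
    ring
  simp_rw [h4]
  rw [← Finset.mul_sum, h3, planeWave]
  ring

theorem iterate_shiftedLaplacian_planeWave (α : ℝ) (k : ℕ) (t : EuclideanSpace ℝ (Fin n))
    (θ : ℝ) : (shiftedLaplacian n α)^[k] (planeWave t θ) =
      fun y => (‖t‖ ^ 2 + α) ^ k * planeWave t θ y := by
  induction k with
  | zero => simp
  | succ k ih => rw [Function.iterate_succ_apply', ih, shiftedLaplacian_planeWave,
      pow_succ (‖t‖ ^ 2 + α) k]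

/-- Smooth cutoffs that exhaust the space, with uniformly bounded derivatives. -/
theorem exists_cutoff_sequence (n m : ℕ) :
    ∃ (χ : ℕ → EuclideanSpace ℝ (Fin n) → ℝ) (C : ℝ), 0 ≤ C ∧
      (∀ N, ContDiff ℝ ∞ (χ N)) ∧ (∀ N, HasCompactSupport (χ N)) ∧
      (∀ (N : ℕ) y, ‖y‖ < N → χ N =ᶠ[nhds y] 1) ∧
      ∀ N, ∀ i ≤ m, ∀ y, ‖iteratedFDeriv ℝ i (χ N) y‖ ≤ C := by
  let β : ContDiffBump (0 : EuclideanSpace ℝ (Fin n)) := ⟨1, 2, one_pos, one_lt_two⟩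
  have hβ : ContDiff ℝ ∞ β := β.contDiff
  have hb : ∀ i : ℕ, ∃ C : ℝ, ∀ y, ‖iteratedFDeriv ℝ i β y‖ ≤ C := fun i =>
    ((contDiff_infty.1 hβ i).continuous_iteratedFDeriv le_rfl).bounded_above_of_compact_support
      (β.hasCompactSupport.iteratedFDeriv i)
  choose C hC using hb
  have hC0 : ∀ i, 0 ≤ C i := fun i => (norm_nonneg _).trans (hC i 0)
  -- Contractions by $N+1$ rather than $N$: the scale is nonzero for $N=0$, and norms at most $1$ do
  -- not increase derivatives of the fixed bump.
  let A : ℕ → EuclideanSpace ℝ (Fin n) →L[ℝ] EuclideanSpace ℝ (Fin n) :=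
    fun N => ((N : ℝ) + 1)⁻¹ • ContinuousLinearMap.id ℝ _
  have hpos : ∀ N : ℕ, (0 : ℝ) < (N + 1 : ℝ) := fun N => by positivity
  refine ⟨fun N y => β (A N y), ∑ i ∈ Finset.range (m + 1), C i,
    Finset.sum_nonneg fun i _ => hC0 i, fun N => hβ.comp (A N).contDiff, fun N => ?_,
    fun N y hy => ?_, fun N i hi y => ?_⟩
  · exact β.hasCompactSupport.comp_homeomorph
      (Homeomorph.smulOfNeZero ((N : ℝ) + 1)⁻¹ (inv_ne_zero (hpos N).ne'))
  · have hopen : IsOpen {z : EuclideanSpace ℝ (Fin n) | ‖z‖ < N} :=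
      isOpen_lt continuous_norm continuous_const
    filter_upwards [hopen.mem_nhds hy] with z (hz : ‖z‖ < N)
    refine β.one_of_mem_closedBall ?_
    rw [mem_closedBall_zero_iff]
    simp only [A, smul_apply, ContinuousLinearMap.id_apply, norm_smul, norm_inv,
      Real.norm_of_nonneg (hpos N).le]
    show (N + 1 : ℝ)⁻¹ * ‖z‖ ≤ 1
    rw [inv_mul_le_iff₀ (hpos N)]
    linarith
  · refine (norm_iteratedFDeriv_comp_clm_le (A N) hβ i y).trans ?_
    have hA : ‖A N‖ ≤ 1 := by
      simp only [A, norm_smul, norm_inv, Real.norm_of_nonneg (hpos N).le]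
      refine mul_le_one₀ (inv_le_one_of_one_le₀ ?_) (norm_nonneg _)
        ContinuousLinearMap.norm_id_le
      have : (0 : ℝ) ≤ N := Nat.cast_nonneg N
      linarith
    calc ‖iteratedFDeriv ℝ i β (A N y)‖ * ‖A N‖ ^ i ≤ C i * 1 := by
          gcongr
          · exact hC0 i
          · exact hC i _
          · exact pow_le_one₀ (norm_nonneg _) hA
      _ = C i := mul_one _
      _ ≤ _ := Finset.single_le_sum (fun i _ => hC0 i) (Finset.mem_range.2 (by omega))

/-- An integrable function annihilated by `(Δ_ξ + α)^k` in the sense of distributions is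
orthogonal to all plane waves. -/
theorem integral_mul_planeWave_eq_zero {k : ℕ} {α : ℝ} (hα : 0 < α)
    {w : EuclideanSpace ℝ (Fin n) → ℝ} (hw : Integrable w)
    (h : ∀ φ : EuclideanSpace ℝ (Fin n) → ℝ, ContDiff ℝ ∞ φ → HasCompactSupport φ →
      ∫ y, w y * (shiftedLaplacian n α)^[k] φ y = 0)
    (t : EuclideanSpace ℝ (Fin n)) (θ : ℝ) : ∫ y, w y * planeWave t θ y = 0 := by
  obtain ⟨χ, C, hC, hχ, hχc, hχ1, hχb⟩ := exists_cutoff_sequence n (2 * k)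
  obtain ⟨K, hK, hKb⟩ := exists_bound_iterate_shiftedLaplacian n α k
  have hf := contDiff_planeWave t θ
  set f := planeWave t θ
  -- Leibniz: the binomial coefficients sum to at most $2^{2k}$, and the base $1+\|t\|\ge1$ absorbs
  -- all lower powers of $\|t\|$.
  set M : ℝ := 2 ^ (2 * k) * (C * (1 + ‖t‖) ^ (2 * k))
  have hsm : ∀ N, ContDiff ℝ ∞ fun y => χ N y * f y := fun N => (hχ N).mul hf
  have hM : ∀ N, ∀ i ≤ 2 * k, ∀ y, ‖iteratedFDeriv ℝ i (fun y => χ N y * f y) y‖ ≤ M := by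
    intro N i hi y
    refine (norm_iteratedFDeriv_mul_le (hχ N) hf y (by exact_mod_cast le_top)).trans ?_
    calc _ ≤ ∑ j ∈ Finset.range (i + 1), (i.choose j : ℝ) * C * (1 + ‖t‖) ^ (2 * k) := by
          gcongr with j hj
          · exact hχb N j (by have := Finset.mem_range.1 hj; omega) y
          · refine (norm_iteratedFDeriv_planeWave_le t θ _ y).trans ?_
            have : (0 : ℝ) ≤ ‖t‖ := norm_nonneg t
            calc ‖t‖ ^ (i - j) ≤ (1 + ‖t‖) ^ (i - j) := by gcongr; linarith
              _ ≤ (1 + ‖t‖) ^ (2 * k) := pow_le_pow_right₀ (by linarith) (by omega)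
      _ = 2 ^ i * (C * (1 + ‖t‖) ^ (2 * k)) := by
          simp_rw [mul_assoc]
          rw [← Finset.sum_mul, ← Nat.cast_sum, Nat.sum_range_choose]; push_cast; ring
      _ ≤ M := by
          simp only [M]
          gcongr
          norm_num
  have hlim : Filter.Tendsto
      (fun N : ℕ => ∫ y, w y * (shiftedLaplacian n α)^[k] (fun y => χ N y * f y) y) Filter.atTop
      (nhds (∫ y, w y * (shiftedLaplacian n α)^[k] f y)) := by
    refine tendsto_integral_of_dominated_convergence (fun y => ‖w y‖ * (K * M)) (fun N => ?_)
      (hw.norm.mul_const _) (fun N => ae_of_all _ fun y => ?_) (ae_of_all _ fun y => ?_)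
    · exact hw.aestronglyMeasurable.mul
        (contDiff_iterate_shiftedLaplacian α k (hsm N)).continuous.aestronglyMeasurable
    · rw [norm_mul]
      gcongr
      exact hKb _ (hsm N) M (hM N) y
    -- Pointwise convergence is eventual equality: the operator is local and the cutoff is $1$ near
    -- $y$ once $N>\|y\|$.
    · obtain ⟨N₀, hN₀⟩ := exists_nat_gt ‖y‖
      refine tendsto_const_nhds.congr' ?_
      filter_upwards [Filter.eventually_ge_atTop N₀] with N hN
      have hy : ‖y‖ < N := hN₀.trans_le (by exact_mod_cast hN)
      have : f =ᶠ[nhds y] fun y => χ N y * f y := by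
        filter_upwards [hχ1 N y hy] with z hz
        rw [hz]; simp
      rw [(iterate_shiftedLaplacian_congr α k this).eq_of_nhds]
  simp_rw [fun N => h _ (hsm N) (hχc N).mul_right] at hlim
  have h0 := tendsto_nhds_unique tendsto_const_nhds hlim
  rw [iterate_shiftedLaplacian_planeWave] at h0
  have hl : (‖t‖ ^ 2 + α) ^ k ≠ 0 := by positivity
  have e : ∫ y, w y * ((‖t‖ ^ 2 + α) ^ k * f y) = (‖t‖ ^ 2 + α) ^ k * ∫ y, w y * f y := by
    rw [← integral_const_mul]
    congr 1 with y
    ring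
  rw [e] at h0
  exact (mul_eq_zero.1 h0.symm).resolve_left hl

open scoped FourierTransform SchwartzMap in
theorem ae_eq_zero_of_integral_mul_planeWave {w : EuclideanSpace ℝ (Fin n) → ℝ}
    (hw : Integrable w) (h : ∀ t θ, ∫ y, w y * planeWave t θ y = 0) : ∀ᵐ y, w y = 0 := by
  have hF : ∀ ξ, 𝓕 (fun y => (w y : ℂ)) ξ = 0 := by
    intro ξ
    have hint : ∀ θ, Integrable fun y => w y * planeWave ((2 * π) • ξ) θ y := fun θ =>
      hw.mul_bdd (c := 1) (contDiff_planeWave _ _).continuous.aestronglyMeasurable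
        (ae_of_all _ fun y => abs_cos_le_one _)
    rw [fourier_eq']
    -- Phases $0$ and $\pi/2$ supply the real and imaginary parts of the character.
    have e : ∀ y, Complex.exp ((↑(-2 * π * inner ℝ y ξ) * Complex.I)) • (w y : ℂ) =
        ((w y * planeWave ((2 * π) • ξ) 0 y : ℝ) : ℂ) +
          ((w y * planeWave ((2 * π) • ξ) (π / 2) y : ℝ) : ℂ) * Complex.I := by
      intro y
      rw [planeWave, planeWave, add_zero, cos_add_pi_div_two, inner_smul_left, real_inner_comm,
        Complex.exp_mul_I, ← Complex.ofReal_cos, ← Complex.ofReal_sin, neg_mul, neg_mul, cos_neg,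
        sin_neg]
      simp
      ring
    simp_rw [e]
    rw [integral_add (hint 0).ofReal ((hint _).ofReal.mul_const _), integral_mul_const,
      integral_complex_ofReal, integral_complex_ofReal, h, h]
    simp
  refine ae_eq_zero_of_integral_contDiff_smul_eq_zero hw.locallyIntegrable fun g hg hgc => ?_
  have hgc' : HasCompactSupport fun y => (g y : ℂ) := hgc.comp_left Complex.ofReal_zero
  set G := hgc'.toSchwartzMap (Complex.ofRealCLM.contDiff.comp hg)
  -- A test function is the transform of a Schwartz function, so the multiplication formula moves
  -- the transform onto `w`, where it vanishes.
  have h1 := VectorFourier.integral_fourierIntegral_smul_eq_flip (L := innerₗ _)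
    Real.continuous_fourierChar continuous_inner ((𝓕⁻ G).integrable (μ := volume))
    (hw.ofReal (𝕜 := ℂ))
  have h2 : ∀ y, 𝓕 (𝓕⁻ G) y = (g y : ℂ) := fun y => by
    rw [FourierTransform.fourier_fourierInv_eq]; rfl
  have h3 : ∫ y, 𝓕 (𝓕⁻ G) y • (w y : ℂ) = ∫ ξ, (𝓕⁻ G) ξ • 𝓕 (fun y => (w y : ℂ)) ξ := by
    rw [flip_innerₗ] at h1; exact h1
  simp_rw [h2, hF] at h3
  have h4 : ∫ y, ((g y • w y : ℝ) : ℂ) = 0 := by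
    simpa using h3
  rw [integral_complex_ofReal] at h4
  exact_mod_cast h4

theorem MemClassH.integrableOn_compl_closedBall {k : ℕ}
    {u : EuclideanSpace ℝ (Fin n) → EuclideanSpace ℝ (Fin n) → ℝ} (hu : MemClassH n k u)
    (x : EuclideanSpace ℝ (Fin n)) (hm : AEStronglyMeasurable (u x) volume) :
    IntegrableOn (u x) (Metric.closedBall x 1)ᶜ := by
  obtain ⟨C, hC, h⟩ := hu.bound_far (n + 1) (by have : (0 : ℝ) ≤ n := Nat.cast_nonneg n; linarith)
  have hI : Integrable fun y : EuclideanSpace ℝ (Fin n) => (1 + ‖x - y‖) ^ (-((n : ℝ) + 1)) :=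
    (integrable_one_add_norm (E := EuclideanSpace ℝ (Fin n)) (r := (n : ℝ) + 1)
      (by simp)).comp_sub_left x
  refine Integrable.mono' (hI.const_mul (C * 2 ^ ((n : ℝ) + 1))).integrableOn hm.restrict ?_
  refine (ae_restrict_iff' Metric.isClosed_closedBall.measurableSet.compl).2
    (ae_of_all _ fun y hy => ?_)
  have hy1 : 1 < ‖x - y‖ := by
    rw [mem_compl_iff, Metric.mem_closedBall, dist_comm, dist_eq_norm] at hy
    exact not_le.1 hy
  have h1 := h 0 (Nat.zero_le _) x y hy1.le
  rw [norm_iteratedFDeriv_zero] at h1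
  refine h1.trans ?_
  rw [mul_assoc]
  gcongr
  rw [rpow_neg (by positivity), rpow_neg (by positivity), ← div_eq_mul_inv, ← one_div,
    div_le_div_iff₀ (by positivity) (by positivity), one_mul, ← mul_rpow (by norm_num)
    (by positivity)]
  gcongr
  linarith

/-- Local integrability covers the unit ball around $x$; outside it the decay with exponent $n+1$
suffices. -/
theorem IsGreenFunction.integrable {k : ℕ} {α : ℝ}
    {G : EuclideanSpace ℝ (Fin n) → EuclideanSpace ℝ (Fin n) → ℝ} (hG : IsGreenFunction n k α G)
    (x : EuclideanSpace ℝ (Fin n)) : Integrable (G x) := by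
  have h1 := (hG.isFundamentalSolution x).1
  rw [← integrableOn_univ, ← union_compl_self (Metric.closedBall x 1)]
  exact (h1.integrableOn_isCompact (isCompact_closedBall x 1)).union
    (hG.memClassH.integrableOn_compl_closedBall x h1.aestronglyMeasurable)

theorem MemClassH.continuousOn {k : ℕ}
    {u : EuclideanSpace ℝ (Fin n) → EuclideanSpace ℝ (Fin n) → ℝ} (hu : MemClassH n k u)
    (x : EuclideanSpace ℝ (Fin n)) : ContinuousOn (u x) {y | x ≠ y} :=
  hu.contDiffOn.continuousOn.comp (f := fun y => (x, y)) (by fun_prop) fun _ hy => hy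

theorem IsGreenFunction.unique {k : ℕ} {α : ℝ} (hα : 0 < α)
    {G₁ G₂ : EuclideanSpace ℝ (Fin n) → EuclideanSpace ℝ (Fin n) → ℝ}
    (h₁ : IsGreenFunction n k α G₁) (h₂ : IsGreenFunction n k α G₂)
    {x y : EuclideanSpace ℝ (Fin n)} (hxy : x ≠ y) : G₁ x y = G₂ x y := by
  have hI₁ := h₁.integrable x
  have hI₂ := h₂.integrable x
  have hae : ∀ᵐ z, (G₁ x - G₂ x) z = 0 := by
    refine ae_eq_zero_of_integral_mul_planeWave (hI₁.sub hI₂)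
      (integral_mul_planeWave_eq_zero (k := k) hα (hI₁.sub hI₂) fun φ hφ hφc => ?_)
    have hL := contDiff_iterate_shiftedLaplacian α k hφ
    obtain ⟨K, hK⟩ : ∃ K, ∀ z, ‖(shiftedLaplacian n α)^[k] φ z‖ ≤ K := by
      obtain ⟨K, _, hK⟩ := exists_bound_iterate_shiftedLaplacian n α k
      have hb : ∀ i : ℕ, ∃ C : ℝ, ∀ y, ‖iteratedFDeriv ℝ i φ y‖ ≤ C := fun i =>
        ((contDiff_infty.1 hφ i).continuous_iteratedFDeriv le_rfl).bounded_above_of_compact_support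
          (hφc.iteratedFDeriv i)
      choose C hC using hb
      refine ⟨_, hK φ hφ (∑ i ∈ Finset.range (2 * k + 1), C i) fun i hi z => (hC i z).trans ?_⟩
      exact Finset.single_le_sum (fun i _ => (norm_nonneg _).trans (hC i 0))
        (Finset.mem_range.2 (by omega))
    have hint : ∀ {w : EuclideanSpace ℝ (Fin n) → ℝ}, Integrable w →
        Integrable fun z => w z * (shiftedLaplacian n α)^[k] φ z := fun hw =>
      hw.mul_bdd hL.continuous.aestronglyMeasurable (ae_of_all _ hK)
    simp only [Pi.sub_apply, sub_mul]
    rw [integral_sub (hint hI₁) (hint hI₂), (h₁.isFundamentalSolution x).2 φ hφ hφc,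
      (h₂.isFundamentalSolution x).2 φ hφ hφc, sub_self]
  have hU : IsOpen {z | x ≠ z} := isOpen_ne_fun continuous_const continuous_id
  -- Both functions are continuous off the diagonal, which upgrades almost-everywhere equality to
  -- equality there.
  refine Measure.eqOn_open_of_ae_eq (μ := volume) (U := {z | x ≠ z}) ?_ hU
    (h₁.memClassH.continuousOn x) (h₂.memClassH.continuousOn x) hxy
  refine ae_restrict_of_ae ?_
  filter_upwards [hae] with z hz
  exact sub_eq_zero.1 hz

end BoundedDerivatives

/-! ### Transfer from the explicit kernel to an arbitrary Green's function. -/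

theorem IsGreenFunction.eq_greenKernel {n k : ℕ} (hk : 1 ≤ k) (hn : 2 * k < n) {α : ℝ}
    (hα : 0 < α) {G : EuclideanSpace ℝ (Fin n) → EuclideanSpace ℝ (Fin n) → ℝ}
    (hG : IsGreenFunction n k α G) {x y : EuclideanSpace ℝ (Fin n)} (hxy : x ≠ y) :
    G x y = greenKernel n k α x y :=
  hG.unique hα
    ⟨memClassH_greenKernel n k hn hα, isFundamentalSolution_greenKernel k hk hα⟩ hxy

theorem proposition2p8 (n k : ℕ) (hk : 1 ≤ k) (hn : 2 * k < n) :
    -- the Green's function in the class `ℌ_k` exists and is unique off the diagonal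
    (∀ α : ℝ, 0 < α →
      (∃ G : EuclideanSpace ℝ (Fin n) → EuclideanSpace ℝ (Fin n) → ℝ, IsGreenFunction n k α G) ∧
      ∀ G₁ G₂ : EuclideanSpace ℝ (Fin n) → EuclideanSpace ℝ (Fin n) → ℝ,
        IsGreenFunction n k α G₁ → IsGreenFunction n k α G₂ → ∀ x y, x ≠ y → G₁ x y = G₂ x y) ∧
    -- the expansion near the diagonal, with a constant independent of `α`
    (∃ C : ℝ, 0 < C ∧ ∀ α : ℝ, 0 < α →
      ∀ G : EuclideanSpace ℝ (Fin n) → EuclideanSpace ℝ (Fin n) → ℝ, IsGreenFunction n k α G →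
        ∀ x y : EuclideanSpace ℝ (Fin n), x ≠ y → √α * ‖x - y‖ ≤ 1 →
          ∃ ε : ℝ, |ε| ≤ C * greenEta n k (√α * ‖x - y‖) ∧
            G x y = greenConst n k * ‖x - y‖ ^ (2 * (k : ℝ) - n) * (1 + ε)) ∧
    -- the estimates for the derivatives of order `1, …, 2k - 1` in `y`
    (∀ l : ℕ, 1 ≤ l → l ≤ 2 * k - 1 → ∃ C : ℝ, 0 < C ∧ ∀ α : ℝ, 0 < α →
      ∀ G : EuclideanSpace ℝ (Fin n) → EuclideanSpace ℝ (Fin n) → ℝ, IsGreenFunction n k α G →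
        ∀ x y : EuclideanSpace ℝ (Fin n), x ≠ y → √α * ‖x - y‖ ≤ 1 →
          ‖iteratedFDeriv ℝ l (fun z => ‖x - z‖ ^ ((n : ℝ) - 2 * k) * G x z) y‖
            ≤ C * ‖x - y‖ ^ (-(l : ℝ)) * greenEta n k (√α * ‖x - y‖)) := by
  refine ⟨fun α hα => ⟨⟨greenKernel n k α, ?_⟩, fun G₁ G₂ h₁ h₂ x y hxy => h₁.unique hα h₂ hxy⟩,
    ?_, fun l hl _ => ?_⟩
  · exact ⟨memClassH_greenKernel n k hn hα, isFundamentalSolution_greenKernel k hk hα⟩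
  · obtain ⟨C, hC, h⟩ := greenKernel_expansion n k hn
    refine ⟨C, hC, fun α hα G hG x y hxy ht => ?_⟩
    rw [hG.eq_greenKernel hk hn hα hxy]
    exact h α hα x y hxy ht
  · obtain ⟨C, hC, h⟩ := norm_iteratedFDeriv_greenKernel_le n k hn l hl
    refine ⟨C, hC, fun α hα G hG x y hxy ht => ?_⟩
    -- The derivative at $y$ depends only on the germ there, and a neighbourhood of $y$ avoids $x$,
    -- so the diagonal values of `G` are irrelevant.
    have hev : (fun z => ‖x - z‖ ^ ((n : ℝ) - 2 * k) * G x z) =ᶠ[nhds y]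
        fun z => ‖x - z‖ ^ ((n : ℝ) - 2 * k) * greenKernel n k α x z := by
      filter_upwards [isOpen_ne.mem_nhds hxy.symm] with z (hz : z ≠ x)
      rw [hG.eq_greenKernel hk hn hα hz.symm]
    rw [(hev.iteratedFDeriv ℝ l).eq_of_nhds]
    exact h α hα x y hxy ht
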